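/- Let $X$ be a compact connected complex manifold with structure sheaf $\mathcal{O}_X$ of holomorphic functions, let $Z\subset X$ be a connected (non-empty) analytic subset of codimension $1$, and let $j\colon Z\hookrightarrow X$ and $i\colon X\setminus Z\hookrightarrow X$ be the inclusions; $i^{-1}$ and $j^{-1}$ denote the topological inverse image functors. Let $\mathcal{F}$ be a sheaf of $\mathbb{C}$-vector spaces on $X$ (not necessarily coherent) such that $i^{-1}\mathcal{F}\cong\mathcal{O}_{X\setminus Z}$ as sheaves of $\mathbb{C}$-vector spaces and $\dim_{\mathbb{C}}H^1(X,\mathcal{F})=m<\infty$. A non-compact complex manifold $Y$ is said to admit the Hartogs phenomenon if for every compact set $K\subset Y$ such that $Y\setminus K$ is connected, the restriction homomorphism $\Gamma(Y,\mathcal{O}_Y)\to\Gamma(Y\setminus K,\mathcal{O}_Y)$ is an isomorphism. Then $\Gamma(Z,j^{-1}\mathcal{F})=\varinjlim_{U\supset Z}\Gamma(U,\mathcal{F})$ via the canonical maps, where $U$ runs over the open neighbourhoods of $Z$ in $X$, and the following assertions are equivalent: 1. $X\setminus Z$ admits the Hartogs phenomenon; 2. the canonical homomorphism $\Gamma(X,\mathcal{F})\to\Gamma(Z,j^{-1}\mathcal{F})$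 is surjective; 3. $\dim_{\mathbb{C}}H^1_c(X\setminus Z,\mathcal{O}_{X\setminus Z})\le m$. -/

import Mathlib

open CategoryTheory TopologicalSpace Opposite
open scoped Manifold ContDiff

noncomputable section

namespace Hartogs

/-! ### Holomorphic functions and the structure sheaf

A complex manifold of dimension `n` is a Hausdorff space with an analytic atlas modelled on `ℂⁿ`:
`[TopologicalSpace M] [T2Space M] [ChartedSpace (EuclideanSpace ℂ (Fin n)) M]
[IsManifold 𝓘(ℂ, EuclideanSpace ℂ (Fin n)) ω M]`. A holomorphic function is an analytic one. -/

section StructureSheaf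

variable (n : ℕ) (M : Type) [TopologicalSpace M] [ChartedSpace (EuclideanSpace ℂ (Fin n)) M]

/-- Restriction of holomorphic functions from an open set `V` to a smaller open set `U`,
as a `ℂ`-linear map. -/
def restrictHol {U V : Opens M} (h : U ≤ V) :
    C^ω⟮𝓘(ℂ, EuclideanSpace ℂ (Fin n)), V; 𝓘(ℂ, ℂ), ℂ⟯ →ₗ[ℂ]
      C^ω⟮𝓘(ℂ, EuclideanSpace ℂ (Fin n)), U; 𝓘(ℂ, ℂ), ℂ⟯ where
  toFun f := ⟨f ∘ Set.inclusion h, f.contMDiff.comp (contMDiff_inclusion h)⟩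
  map_add' _ _ := rfl
  map_smul' _ _ := rfl

/-- The presheaf `U ↦ {holomorphic functions U → ℂ}` of `ℂ`-vector spaces. -/
def structurePresheaf : TopCat.Presheaf (ModuleCat.{0} ℂ) (TopCat.of M) where
  obj U := ModuleCat.of ℂ
    C^ω⟮𝓘(ℂ, EuclideanSpace ℂ (Fin n)), (unop U : Opens M); 𝓘(ℂ, ℂ), ℂ⟯
  map h := ModuleCat.ofHom (restrictHol n M (leOfHom h.unop))
  map_id _ := rfl
  map_comp _ _ := rfl

/-- The structure sheaf `𝒪_M` of holomorphic functions, as a sheaf of `ℂ`-vector spaces. -/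
def structureSheaf : TopCat.Sheaf (ModuleCat.{0} ℂ) (TopCat.of M) where
  obj := structurePresheaf n M
  property := by
    rw [CategoryTheory.Presheaf.isSheaf_iff_isSheaf_forget _ _ (forget (ModuleCat.{0} ℂ))]
    exact ((contDiffWithinAt_localInvariantProp
      (I := 𝓘(ℂ, EuclideanSpace ℂ (Fin n))) (I' := 𝓘(ℂ, ℂ)) ω).sheaf M ℂ).property

/-- The (non-compact) complex manifold `M` admits the Hartogs phenomenon: for every compact `K ⊆ M`
with connected complement, restriction `Γ(M, 𝒪) → Γ(M ∖ K, 𝒪)` is an isomorphism. -/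
def HartogsPhenomenon [T2Space M] : Prop :=
  ∀ (K : Set M) (hK : IsCompact K), IsConnected Kᶜ →
    Function.Bijective ((structureSheaf n M).presheaf.map
      (homOfLE (le_top : (⟨Kᶜ, hK.isClosed.isOpen_compl⟩ : Opens (TopCat.of M)) ≤ ⊤)).op)

end StructureSheaf

/-! ### Analytic subsets and their codimension -/

section AnalyticSet

variable (n : ℕ) {M : Type} [TopologicalSpace M] [ChartedSpace (EuclideanSpace ℂ (Fin n)) M]

/-- `A` is an analytic subset of `M`: every point of `M` has an open neighbourhood `U` on which `A`
is the common zero set of finitely many holomorphic functions. -/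
def IsAnalyticSet (A : Set M) : Prop :=
  ∀ x : M, ∃ U : Set M, IsOpen U ∧ x ∈ U ∧ ∃ (k : ℕ) (g : Fin k → M → ℂ),
    (∀ i, ContMDiffOn 𝓘(ℂ, EuclideanSpace ℂ (Fin n)) 𝓘(ℂ, ℂ) ω (g i) U) ∧
    A ∩ U = {y | y ∈ U ∧ ∀ i, g i y = 0}

/-- The differential at `x` of a function on `M`, a linear form on the tangent space `ℂⁿ`. -/
def differential (f : M → ℂ) (x : M) : EuclideanSpace ℂ (Fin n) →L[ℂ] ℂ :=
  mfderiv 𝓘(ℂ, EuclideanSpace ℂ (Fin n)) 𝓘(ℂ, ℂ) f x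

/-- `x` is a point of `A` near which `A` is a complex submanifold of codimension `k`: near `x`,
`A` is the common zero set of `k` holomorphic functions with linearly independent differentials
at `x`. -/
def IsRegularPoint (A : Set M) (k : ℕ) (x : M) : Prop :=
  x ∈ A ∧ ∃ U : Set M, IsOpen U ∧ x ∈ U ∧ ∃ g : Fin k → M → ℂ,
    (∀ i, ContMDiffOn 𝓘(ℂ, EuclideanSpace ℂ (Fin n)) 𝓘(ℂ, ℂ) ω (g i) U) ∧
    A ∩ U = {y | y ∈ U ∧ ∀ i, g i y = 0} ∧
    LinearIndependent ℂ (fun i : Fin k => differential n (g i) x)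

/-- The codimension of the analytic set `A` is `k`: `k` is the smallest codimension of `A` at a
regular point (so `dim A = n - k` is the largest dimension of a regular piece of `A`). -/
def HasCodim (A : Set M) (k : ℕ) : Prop :=
  IsLeast {j : ℕ | ∃ x, IsRegularPoint n A j x} k

variable {n}

/-- Analytic subsets are closed. -/
theorem IsAnalyticSet.isClosed {A : Set M} (hA : IsAnalyticSet n A) : IsClosed A := by
  rw [← isOpen_compl_iff, isOpen_iff_mem_nhds]
  intro x hx
  obtain ⟨U, hU, hxU, k, g, hg, h⟩ := hA x
  have hx' : ∃ i, g i x ≠ 0 := by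
    by_contra hcon
    push Not at hcon
    have : x ∈ A ∩ U := by rw [h]; exact ⟨hxU, hcon⟩
    exact hx this.1
  obtain ⟨i, hi⟩ := hx'
  have hc : ContinuousAt (g i) x := (hg i).continuousOn.continuousAt (hU.mem_nhds hxU)
  filter_upwards [hc.eventually_ne hi, hU.mem_nhds hxU] with y hy hyU hyA
  have : y ∈ A ∩ U := ⟨hyA, hyU⟩
  rw [h] at this
  exact hy (this.2 i)

/-- The open complement `M ∖ A` of an analytic subset. -/
def IsAnalyticSet.compl {A : Set M} (hA : IsAnalyticSet n A) : Opens M :=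
  ⟨Aᶜ, hA.isClosed.isOpen_compl⟩

end AnalyticSet

/-! ### Cohomology and cohomology with compact supports -/

section Cohomology

variable (Y : TopCat.{0})

/-- The functor `Γ(Y, -)` of global sections. -/
def globalSections : TopCat.Sheaf (ModuleCat.{0} ℂ) Y ⥤ ModuleCat.{0} ℂ where
  obj F := F.presheaf.obj (op ⊤)
  map φ := φ.1.app (op ⊤)

instance : (globalSections Y).Additive where
  map_add := rfl

/-- `H^q(Y, F)`: the right derived functors of `Γ(Y, -)`. -/
def cohomology (q : ℕ) (F : TopCat.Sheaf (ModuleCat.{0} ℂ) Y) : ModuleCat.{0} ℂ :=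
  ((globalSections Y).rightDerived q).obj F

variable {Y}

/-- The support of a global section: the points near which it does not vanish identically. -/
def sectionSupport (F : TopCat.Sheaf (ModuleCat.{0} ℂ) Y)
    (s : F.presheaf.obj (op ⊤)) : Set Y :=
  {y | ∀ U : Opens Y, y ∈ U → F.presheaf.map (homOfLE (le_top : U ≤ ⊤)).op s ≠ 0}

theorem isClosed_sectionSupport (F : TopCat.Sheaf (ModuleCat.{0} ℂ) Y)
    (s : F.presheaf.obj (op ⊤)) : IsClosed (sectionSupport F s) := by
  rw [← isOpen_compl_iff, isOpen_iff_mem_nhds]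
  intro y hy
  simp only [sectionSupport, Set.mem_compl_iff, Set.mem_ofPred_eq, not_forall, not_not] at hy
  obtain ⟨U, hyU, hU⟩ := hy
  filter_upwards [U.isOpen.mem_nhds hyU] with z hz hz'
  exact hz' U hz hU

/-- The subspace `Γ_c(Y, F)` of global sections with compact support. -/
def compactSections (F : TopCat.Sheaf (ModuleCat.{0} ℂ) Y) :
    Submodule ℂ (F.presheaf.obj (op ⊤)) where
  carrier := {s | IsCompact (sectionSupport F s)}
  zero_mem' := by
    have : sectionSupport F 0 = ∅ := by
      ext y
      simp only [sectionSupport, Set.mem_ofPred_eq, Set.mem_empty_iff_false, iff_false, not_forall]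
      exact ⟨⊤, trivial, by simp⟩
    simp [this]
  add_mem' := by
    intro s t hs ht
    refine (hs.union ht).of_isClosed_subset (isClosed_sectionSupport F _) ?_
    intro y hy
    by_contra hcon
    simp only [sectionSupport, Set.mem_union, Set.mem_ofPred_eq, not_or, not_forall, not_not] at hcon
    obtain ⟨⟨U, hyU, hU⟩, ⟨V, hyV, hV⟩⟩ := hcon
    refine hy (U ⊓ V) ⟨hyU, hyV⟩ ?_
    have e₁ : (homOfLE (le_top : U ⊓ V ≤ ⊤)).op =
        (homOfLE (le_top : U ≤ ⊤)).op ≫ (homOfLE (inf_le_left : U ⊓ V ≤ U)).op := rfl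
    have e₂ : (homOfLE (le_top : U ⊓ V ≤ ⊤)).op =
        (homOfLE (le_top : V ≤ ⊤)).op ≫ (homOfLE (inf_le_right : U ⊓ V ≤ V)).op := rfl
    rw [map_add]
    conv_lhs =>
      congr
      · rw [e₁, Functor.map_comp, ModuleCat.comp_apply, hU, map_zero]
      · rw [e₂, Functor.map_comp, ModuleCat.comp_apply, hV, map_zero]
    simp
  smul_mem' := by
    intro c s hs
    refine hs.of_isClosed_subset (isClosed_sectionSupport F _) ?_
    intro y hy U hyU h
    exact hy U hyU (by rw [map_smul, h, smul_zero])

theorem map_mem_compactSections {F G : TopCat.Sheaf (ModuleCat.{0} ℂ) Y} (φ : F ⟶ G)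
    (s : F.presheaf.obj (op ⊤)) (hs : s ∈ compactSections F) :
    φ.1.app (op ⊤) s ∈ compactSections G := by
  refine IsCompact.of_isClosed_subset (s := sectionSupport F s) hs
    (isClosed_sectionSupport G _) ?_
  intro y hy U hyU h
  refine hy U hyU ?_
  have := ConcreteCategory.congr_hom (φ.1.naturality (homOfLE (le_top : U ≤ ⊤)).op) s
  rw [ModuleCat.comp_apply, ModuleCat.comp_apply] at this
  exact this.symm.trans ((congrArg _ h).trans (map_zero _))

variable (Y)

/-- The functor `Γ_c(Y, -)` of global sections with compact support. -/
def compactGlobalSections : TopCat.Sheaf (ModuleCat.{0} ℂ) Y ⥤ ModuleCat.{0} ℂ where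
  obj F := ModuleCat.of ℂ (compactSections F)
  map φ := ModuleCat.ofHom
    ((φ.1.app (op ⊤)).hom.restrict (map_mem_compactSections φ))
  map_id _ := rfl
  map_comp _ _ := rfl

instance : (compactGlobalSections Y).Additive where
  map_add := rfl

/-- `H^q_c(Y, F)`: the right derived functors of `Γ_c(Y, -)`. -/
def compactCohomology (q : ℕ) (F : TopCat.Sheaf (ModuleCat.{0} ℂ) Y) : ModuleCat.{0} ℂ :=
  ((compactGlobalSections Y).rightDerived q).obj F

end Cohomology

/-! ### Inverse images and sections near a subset -/

section InverseImage

variable {X : Type} [TopologicalSpace X]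

/-- The inclusion of a subspace. -/
def incl (A : Set X) : TopCat.of A ⟶ TopCat.of X :=
  TopCat.ofHom ⟨Subtype.val, continuous_subtype_val⟩

/-- The topological inverse image of a sheaf on `X` on a subspace `A`. -/
def inverseImage (A : Set X) (F : TopCat.Sheaf (ModuleCat.{0} ℂ) (TopCat.of X)) :
    TopCat.Sheaf (ModuleCat.{0} ℂ) (TopCat.of A) :=
  (TopCat.Sheaf.pullback (ModuleCat.{0} ℂ) (incl A)).obj F

/-- The canonical map `Γ(U, F) → Γ(A, j⁻¹F)` for an open set `U ⊇ A`, where `j : A → X` is the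
inclusion: the unit `F → j_* j⁻¹F` on `U`, followed by the identification `U ∩ A = A`. -/
def toSectionsOn (A : Set X) (F : TopCat.Sheaf (ModuleCat.{0} ℂ) (TopCat.of X))
    (U : Opens (TopCat.of X)) (hU : A ⊆ U) :
    F.presheaf.obj (op U) ⟶ (inverseImage A F).presheaf.obj (op ⊤) :=
  ((TopCat.Sheaf.pullbackPushforwardAdjunction (ModuleCat.{0} ℂ) (incl A)).unit.app F).1.app (op U) ≫
    (inverseImage A F).presheaf.map
      (homOfLE (fun a _ => hU a.2 : (⊤ : Opens (TopCat.of A)) ≤ (Opens.map (incl A)).obj U)).op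

/-- The canonical map `Γ(X, F) → Γ(A, j⁻¹F)`. -/
def restrictToSubset (A : Set X) (F : TopCat.Sheaf (ModuleCat.{0} ℂ) (TopCat.of X)) :
    F.presheaf.obj (op ⊤) ⟶ (inverseImage A F).presheaf.obj (op ⊤) :=
  toSectionsOn A F ⊤ (Set.subset_univ A)

/-- The open neighbourhoods of `A`. -/
abbrev Nhds (A : Set X) : Type := {U : Opens (TopCat.of X) // A ⊆ U}

/-- The system of sections `Γ(U, F)` over the open neighbourhoods `U` of `A`. -/
def sectionsDiagram (A : Set X) (F : TopCat.Sheaf (ModuleCat.{0} ℂ) (TopCat.of X)) :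
    (Nhds A)ᵒᵖ ⥤ ModuleCat.{0} ℂ :=
  (Subtype.mono_coe (fun U : Opens (TopCat.of X) => A ⊆ U)).functor.op ⋙ F.presheaf

theorem comp_square {C : Type*} [Category C] {a b c d e : C} {p : a ⟶ b} {q : b ⟶ c} {r : c ⟶ d}
    {p' : a ⟶ e} {q' : e ⟶ c} {k : e ⟶ d} (h : p ≫ q = p' ≫ q') (h' : q' ≫ r = k) :
    p ≫ q ≫ r = p' ≫ k := by
  rw [← Category.assoc, h, Category.assoc, h']

/-- The canonical maps `Γ(U, F) → Γ(A, j⁻¹F)`, as a cocone. -/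
def sectionsCocone (A : Set X) (F : TopCat.Sheaf (ModuleCat.{0} ℂ) (TopCat.of X)) :
    Limits.Cocone (sectionsDiagram A F) where
  pt := (inverseImage A F).presheaf.obj (op ⊤)
  ι :=
    { app := fun U => toSectionsOn A F U.unop.1 U.unop.2
      naturality := by
        intro U V f
        have h := ((TopCat.Sheaf.pullbackPushforwardAdjunction (ModuleCat.{0} ℂ)
          (incl A)).unit.app F).1.naturality
            (homOfLE (leOfHom f.unop) : V.unop.1 ⟶ U.unop.1).op
        refine Eq.trans ?_ (Category.comp_id _).symm
        exact comp_square h ((inverseImage A F).presheaf.map_comp _ _).symm }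

end InverseImage

end Hartogs

end

/-!
Write `Y = X ∖ Z`. The three assertions are compared through the spaces `𝒪(Y ∖ K)` for compact
`K ⊆ Y`, and `Γ(V, F)` for neighbourhoods `V` of `Z`.

*Sections near `Z`.* The unit `F → j_* j⁻¹F` is injective and surjective on germs at points of `Z`;
both facts follow from the adjunction of `j⁻¹` and `j_*`, tested against sheaves of discontinuous
families of vectors (`germ_eq_zero_of_unitSec_eq_zero`, `stalkUnit_surjective`). Since `Z` is
compact and `X` is Hausdorff, the local sections of `F` lifting a section of `j⁻¹F` can be glued
(`exists_toSectionsOn_eq`), whence the colimit formula (`nonempty_isColimit_sectionsCocone`).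

*Hartogs implies surjectivity* (`restrictToSubset_surjective`). A section of `j⁻¹F` comes from a
section `t` of `F` on a connected neighbourhood `V` of `Z`. The analytic set `Z` is thin and does
not disconnect `V` (`IsThin.isPreconnected_diff`, a consequence of Riemann's extension theorem), so
`V ∖ Z` is the connected complement of a compact subset of `Y`; there `t` is a holomorphic function,
which extends to `Y` and glues with `t` to a global section of `F`.

*Surjectivity implies the estimate* (`rank_compactCohomology_le`). Restriction to `Y` is exact and
preserves injective sheaves, which are the retracts of sheaves of discontinuous families; so one
injective resolution of `F` computes both `H¹(X, F)` and `H¹_c(Y, F)`. Extension by zero of cocycles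
with support in `Y` is then injective on `H¹`, because a primitive is near `Z` a section of `F`, and
surjectivity allows to correct it by a global section.

*The estimate implies Hartogs* (`hartogsPhenomenon_of_rank_lt`). Extending a holomorphic function on
`Y ∖ K` to a section of the first term of a flasque resolution embeds `𝒪(Y ∖ K) / 𝒪(Y)` into
`H¹_c(Y, 𝒪)`; the embedding uses the identity theorem and the fact that `Y` is not compact. So
`𝒪(Y)` has finite codimension in `𝒪(Y ∖ K)`, and then the two are equal
(`restrictHolAlgHom_surjective`): by linear algebra, every element of a domain `B` is integral over
a subalgebra `A` of finite codimension, and is a quotient of elements of `A` (or else a constant);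
the quotient of two holomorphic functions on `Y`, if it is integral, is locally bounded, and extends
by Riemann's theorem (`exists_contMDiff_mul_eq`). Riemann's theorem itself is obtained by writing
the extension as a Cauchy integral along complex lines, which depends analytically on its centre
(`analyticAt_setIntegral_add`).
-/

/-! ### Analytic dependence of integrals on parameters -/

section

open MeasureTheory Metric Filter Topology NNReal ENNReal

namespace Hartogs

section ParametricIntegral

variable {E F : Type*} [NormedAddCommGroup E] [NormedSpace ℂ E]
  [NormedAddCommGroup F] [NormedSpace ℂ F] [CompleteSpace F]

/-- Analytic dependence on the parameter when the translates `x + γ θ` stay in a ball on which one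
power series represents `f`: its re-expansions at the points `x + γ θ` are integrated term by
term. -/
theorem analyticAt_setIntegral_add_of_norm_lt {f : E → F}
    {p : FormalMultilinearSeries ℂ E F} {c x : E} {r : ℝ≥0} (hr : 0 < r)
    (hf : HasFPowerSeriesOnBall f p c (r + r + r : ℝ≥0))
    {γ : ℝ → E} (hγ : Continuous γ) {w : ℝ → ℂ} (hw : Continuous w)
    {T : Set ℝ} (hT : MeasurableSet T) {K : Set ℝ} (hK : IsCompact K) (hTK : T ⊆ K)
    (hTr : ∀ θ ∈ T, ‖x + γ θ - c‖₊ ≤ r) :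
    AnalyticAt ℂ (fun y => ∫ θ in T, w θ • f (y + γ θ)) x ∧
      ∀ᶠ y in 𝓝 x, IntegrableOn (fun θ => w θ • f (y + γ θ)) T := by
  obtain ⟨C, hC⟩ : ∃ C : ℝ≥0, ∀ θ ∈ T, ‖w θ‖₊ ≤ C := by
    obtain ⟨C, hC⟩ := hK.exists_bound_of_continuousOn hw.continuousOn
    refine ⟨C.toNNReal, fun θ hθ => ?_⟩
    rw [← NNReal.coe_le_coe, coe_nnnorm]
    exact (hC θ (hTK hθ)).trans (Real.le_coe_toNNReal C)
  have hfin : volume T ≠ ⊤ := ((measure_mono hTK).trans_lt hK.measure_lt_top).ne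
  have : IsFiniteMeasure (volume.restrict T) := isFiniteMeasure_restrict.2 hfin
  have hrad : (r + r + r : ℝ≥0) ≤ p.radius := hf.r_le
  have h2 : ((r : ℝ≥0∞) + r) < p.radius := by
    refine lt_of_lt_of_le ?_ hrad
    exact_mod_cast lt_add_of_pos_right _ hr
  have h1 : (r : ℝ≥0∞) < p.radius := lt_of_le_of_lt le_self_add h2
  set z : ℝ → E := fun θ => x + γ θ - c with hz
  have hzc : Continuous z := by fun_prop
  -- the sum over `n` of the bounds `A n * r ^ n` for the shifted series is finite
  set A : ℕ → ℝ≥0 := fun n =>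
    ∑' s : Σ l : ℕ, { s : Finset (Fin (n + l)) // s.card = l }, ‖p (n + s.1)‖₊ * r ^ s.1 with hA
  have hAsum : Summable fun n => A n * r ^ n := by
    have := (NNReal.summable_sigma.1 (p.changeOriginSeries_summable_aux₁ h2)).2
    simpa only [hA, ← NNReal.tsum_mul_right] using this
  have hbound : ∀ θ ∈ T, ∀ n, ‖p.changeOrigin (z θ) n‖₊ ≤ A n := by
    intro θ hθ n
    have hzr : ‖z θ‖₊ ≤ r := hTr θ hθ
    refine (p.nnnorm_changeOrigin_le n (lt_of_le_of_lt (by exact_mod_cast hzr) h1)).trans ?_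
    refine Summable.tsum_le_tsum (fun s => by gcongr) ?_ (p.changeOriginSeries_summable_aux₂ h1 n)
    exact p.changeOriginSeries_summable_aux₂ (lt_of_le_of_lt (by exact_mod_cast hzr) h1) n
  have hmeas : ∀ n, ContinuousOn (fun θ => w θ • p.changeOrigin (z θ) n) T := by
    intro n
    refine hw.continuousOn.smul ?_
    refine (p.hasFPowerSeriesOnBall_changeOrigin n (lt_of_le_of_lt zero_le h1)).continuousOn.comp
      hzc.continuousOn ?_
    intro θ hθ
    rw [mem_eball_zero_iff]
    exact lt_of_le_of_lt (by exact_mod_cast hTr θ hθ) h1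
  have hbound' : ∀ θ ∈ T, ∀ n, ‖w θ • p.changeOrigin (z θ) n‖ ≤ C * A n := by
    intro θ hθ n
    rw [norm_smul]
    exact mul_le_mul (hC θ hθ) (hbound θ hθ n) (norm_nonneg _) C.2
  have hint : ∀ n, Integrable (fun θ => w θ • p.changeOrigin (z θ) n) (volume.restrict T) := by
    intro n
    refine Integrable.of_bound ((hmeas n).aestronglyMeasurable hT) (C * A n) ?_
    exact (ae_restrict_iff' hT).2 (ae_of_all _ fun θ hθ => hbound' θ hθ n)
  have hsum : ∀ θ ∈ T, ∀ h : E, ‖h‖₊ < r →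
      HasSum (fun n => p.changeOrigin (z θ) n fun _ => h) (f (x + h + γ θ)) := by
    intro θ hθ h hh
    have hzr : ‖z θ‖₊ ≤ r := hTr θ hθ
    have := (hf.changeOrigin (y := z θ) (lt_of_le_of_lt (b := (r : ℝ≥0∞))
      (by exact_mod_cast hzr) (by exact_mod_cast
        (lt_add_of_le_of_pos (le_add_of_nonneg_left (zero_le)) hr)))).hasSum (y := h) (by
        rw [mem_eball_zero_iff, lt_tsub_iff_right, enorm_eq_nnnorm]
        have : ‖h‖₊ + ‖z θ‖₊ < r + r + r :=
          lt_of_lt_of_le (add_lt_add_of_lt_of_le hh hzr) le_self_add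
        exact_mod_cast this)
    convert this using 2
    simp only [hz]
    abel
  have hterm : ∀ θ ∈ T, ∀ h : E, ‖h‖₊ < r → ∀ n,
      ‖w θ • p.changeOrigin (z θ) n fun _ => h‖ ≤ C * (A n * r ^ n) := by
    intro θ hθ h hh n
    rw [norm_smul]
    refine mul_le_mul (hC θ hθ) ?_ (norm_nonneg _) C.2
    refine ((p.changeOrigin (z θ) n).le_opNorm _).trans ?_
    rw [Finset.prod_const, Finset.card_univ, Fintype.card_fin]
    exact mul_le_mul (hbound θ hθ n) (pow_le_pow_left₀ (norm_nonneg _) hh.le n)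
      (by positivity) (by positivity)
  have hsumR : Summable fun n => (C : ℝ) * (A n * r ^ n) := by
    refine Summable.mul_left _ ?_
    exact_mod_cast hAsum
  refine ⟨?_, ?_⟩
  · set q : FormalMultilinearSeries ℂ E F :=
      fun n => ∫ θ in T, w θ • p.changeOrigin (z θ) n with hq
    have hball : HasFPowerSeriesOnBall (fun y => ∫ θ in T, w θ • f (y + γ θ)) q x r := by
      refine ⟨?_, by exact_mod_cast hr, ?_⟩
      · refine FormalMultilinearSeries.le_radius_of_bound _
          (C * (volume.restrict T).real Set.univ * ∑' n, ((A n * r ^ n : ℝ≥0) : ℝ)) fun n => ?_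
        have h3 : ‖q n‖ ≤ C * A n * (volume.restrict T).real Set.univ :=
          norm_integral_le_of_norm_le_const
            ((ae_restrict_iff' hT).2 (ae_of_all _ fun θ hθ => hbound' θ hθ n))
        have h4 : ((A n * r ^ n : ℝ≥0) : ℝ) ≤ ∑' n, ((A n * r ^ n : ℝ≥0) : ℝ) :=
          (NNReal.summable_coe.2 hAsum).le_tsum n fun _ _ => NNReal.coe_nonneg _
        calc ‖q n‖ * (r : ℝ) ^ n ≤ C * A n * (volume.restrict T).real Set.univ * (r : ℝ) ^ n := by
              gcongr
          _ = C * (volume.restrict T).real Set.univ * ((A n * r ^ n : ℝ≥0) : ℝ) := by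
              push_cast; ring
          _ ≤ _ := by gcongr
      · intro h hh
        rw [mem_eball_zero_iff] at hh
        have hh' : ‖h‖₊ < r := by exact_mod_cast hh
        have key := hasSum_integral_of_dominated_convergence (μ := volume.restrict T)
          (F := fun n θ => w θ • p.changeOrigin (z θ) n fun _ => h)
          (f := fun θ => w θ • f (x + h + γ θ))
          (bound := fun n _ => C * (A n * r ^ n)) ?_ ?_ ?_ ?_ ?_
        · convert key using 2 with n
          have := (ContinuousMultilinearMap.apply ℂ (fun _ : Fin n => E) F
            (fun _ => h)).integral_comp_comm (hint n)
          exact this.symm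
        · intro n
          refine ContinuousOn.aestronglyMeasurable ?_ hT
          exact (ContinuousMultilinearMap.apply ℂ (fun _ : Fin n => E) F
            (fun _ => h)).continuous.comp_continuousOn (hmeas n)
        · exact fun n => (ae_restrict_iff' hT).2 (ae_of_all _ fun θ hθ => hterm θ hθ h hh' n)
        · exact ae_of_all _ fun _ => hsumR
        · exact integrable_const _
        · exact (ae_restrict_iff' hT).2 (ae_of_all _ fun θ hθ => (hsum θ hθ h hh').const_smul _)
    exact hball.analyticAt
  · filter_upwards [ball_mem_nhds x (show (0 : ℝ) < r from hr)] with y hy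
    obtain ⟨h, rfl⟩ : ∃ h, y = x + h := ⟨y - x, by abel⟩
    have hh : ‖h‖₊ < r := by
      rw [mem_ball, dist_eq_norm, add_sub_cancel_left] at hy
      exact_mod_cast hy
    refine Integrable.of_bound (C := ∑' n, (C : ℝ) * (A n * r ^ n)) ?_ ?_
    · refine ContinuousOn.aestronglyMeasurable ?_ hT
      refine hw.continuousOn.smul (hf.continuousOn.comp (by fun_prop) ?_)
      intro θ hθ
      have : ‖z θ + h‖₊ < r + r + r := by
        refine lt_of_le_of_lt (nnnorm_add_le _ _) ?_
        exact lt_of_lt_of_le (add_lt_add_of_le_of_lt (hTr θ hθ) hh) le_self_add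
      rw [mem_eball, edist_eq_enorm_sub]
      have e : x + h + γ θ - c = z θ + h := by simp only [hz]; abel
      rw [e]
      exact_mod_cast this
    · refine (ae_restrict_iff' hT).2 (ae_of_all _ fun θ hθ => ?_)
      exact ((hsum θ hθ h hh).const_smul (w θ)).norm_le_of_bounded hsumR.hasSum
        (hterm θ hθ h hh)

/-- Analytic dependence of an integral on a parameter: if `f` is analytic at the points of the
compact curve `x + γ(K)`, then `y ↦ ∫_K w(θ) f(y + γ θ) dθ` is analytic at `x`. -/
theorem analyticAt_setIntegral_add {f : E → F} {γ : ℝ → E} (hγ : Continuous γ)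
    {w : ℝ → ℂ} (hw : Continuous w) {K : Set ℝ} (hK : IsCompact K) {x : E}
    (hf : ∀ θ ∈ K, AnalyticAt ℂ f (x + γ θ)) :
    AnalyticAt ℂ (fun y => ∫ θ in K, w θ • f (y + γ θ)) x := by
  have hKm := hK.measurableSet
  suffices h : ∃ S', K ⊆ S' ∧ MeasurableSet S' ∧ ∀ T, MeasurableSet T → T ⊆ K → T ⊆ S' →
      AnalyticAt ℂ (fun y => ∫ θ in T, w θ • f (y + γ θ)) x ∧
      ∀ᶠ y in 𝓝 x, IntegrableOn (fun θ => w θ • f (y + γ θ)) T by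
    obtain ⟨S', h1, _, h⟩ := h
    exact (h K hKm subset_rfl h1).1
  refine hK.induction_on (p := fun S => ∃ S', S ⊆ S' ∧ MeasurableSet S' ∧
    ∀ T, MeasurableSet T → T ⊆ K → T ⊆ S' →
      AnalyticAt ℂ (fun y => ∫ θ in T, w θ • f (y + γ θ)) x ∧
      ∀ᶠ y in 𝓝 x, IntegrableOn (fun θ => w θ • f (y + γ θ)) T) ?_ ?_ ?_ ?_
  · refine ⟨∅, subset_rfl, MeasurableSet.empty, fun T _ _ hT => ?_⟩
    obtain rfl := Set.subset_empty_iff.1 hT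
    simpa using analyticAt_const
  · rintro s t hst ⟨S', h1, h2⟩
    exact ⟨S', hst.trans h1, h2⟩
  · rintro s t ⟨S, hS, hSm, h⟩ ⟨S', hS', hSm', h'⟩
    refine ⟨S ∪ S', Set.union_subset_union hS hS', hSm.union hSm', fun T hT hTK hTS => ?_⟩
    obtain ⟨ha, hi⟩ := h (T ∩ S) (hT.inter hSm) (Set.inter_subset_left.trans hTK)
      Set.inter_subset_right
    obtain ⟨ha', hi'⟩ := h' (T \ S) (hT.diff hSm) (Set.sdiff_subset.trans hTK)
      (fun a ha => (hTS ha.1).resolve_left ha.2)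
    refine ⟨(ha.add ha').congr ?_, ?_⟩
    · filter_upwards [hi, hi'] with y hy hy'
      simp only [Pi.add_apply]
      conv_rhs => rw [← Set.inter_union_sdiff T S]
      exact (setIntegral_union (Set.disjoint_sdiff_inter.symm) (hT.diff hSm) hy hy').symm
    · filter_upwards [hi, hi'] with y hy hy'
      rw [← Set.inter_union_sdiff T S]
      exact hy.union hy'
  · intro θ hθ
    obtain ⟨p, ρ, hp⟩ := hf θ hθ
    obtain ⟨r, hr, hrρ⟩ : ∃ r : ℝ≥0, 0 < r ∧ ((r + r + r : ℝ≥0) : ℝ≥0∞) ≤ ρ := by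
      obtain ⟨s, hs, hsρ⟩ := ENNReal.lt_iff_exists_nnreal_btwn.1 hp.r_pos
      refine ⟨s / 3, by have : 0 < s := by exact_mod_cast hs
                        positivity, ?_⟩
      have : s / 3 + s / 3 + s / 3 = s := by
        rw [← NNReal.coe_inj]; push_cast; ring
      rw [this]; exact hsρ.le
    have hp' : HasFPowerSeriesOnBall f p (x + γ θ) (r + r + r : ℝ≥0) :=
      hp.mono (by exact_mod_cast (by positivity : 0 < r + r + r)) hrρ
    have hopen : IsOpen {η | ‖x + γ η - (x + γ θ)‖₊ < r} :=
      isOpen_lt (by fun_prop) continuous_const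
    refine ⟨{η | ‖x + γ η - (x + γ θ)‖₊ < r}, mem_nhdsWithin_of_mem_nhds
      (hopen.mem_nhds (by simpa using hr)), _, subset_rfl, hopen.measurableSet,
      fun T hT hTK hTS => ?_⟩
    exact analyticAt_setIntegral_add_of_norm_lt hr hp' hγ hw hT hK hTK fun η hη => (hTS hη).le

end ParametricIntegral

end Hartogs

end

/-! ### Riemann's extension theorem -/

section

open MeasureTheory Metric Filter Topology NNReal ENNReal

namespace Hartogs

section RiemannExtension

/-- The Cauchy formula at the centre of a disc for a bounded function which is only assumed to be
holomorphic off the zeros of a holomorphic function `u`. -/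
theorem circleIntegral_eq_of_bounded_of_ne_zero {u φ : ℂ → ℂ} {r R C : ℝ} (hr : 0 < r) (hrR : r < R)
    (hu : AnalyticOnNhd ℂ u (ball 0 R)) (hur : ∀ t ∈ sphere (0 : ℂ) r, u t ≠ 0) (hu0 : u 0 ≠ 0)
    (hφ : ∀ t ∈ ball (0 : ℂ) R, u t ≠ 0 → DifferentiableAt ℂ φ t)
    (hb : ∀ t ∈ ball (0 : ℂ) R, u t ≠ 0 → ‖φ t‖ ≤ C) :
    ((2 * Real.pi * Complex.I : ℂ)⁻¹ • ∮ t in C(0, r), (t - 0)⁻¹ • φ t) = φ 0 := by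
  have hR : 0 < R := hr.trans hrR
  have hne : ∀ t ∈ ball (0 : ℂ) R, ∀ᶠ s in 𝓝[≠] t, u s ≠ 0 := by
    intro t ht
    refine (hu t ht).eventually_eq_zero_or_eventually_ne_zero.resolve_left fun h0 => hu0 ?_
    exact hu.eqOn_zero_of_preconnected_of_eventuallyEq_zero
      (convex_ball (0 : ℂ) R).isPreconnected ht h0 (mem_ball_self hR)
  -- the holomorphic extension of `φ` to the whole disc
  set Φ : ℂ → ℂ := fun t => limUnder (𝓝[≠] t) φ with hΦ
  have hval : ∀ t ∈ ball (0 : ℂ) R, u t ≠ 0 → Φ t = φ t := fun t ht h =>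
    ((hφ t ht h).continuousAt.tendsto.mono_left nhdsWithin_le_nhds).limUnder_eq
  have hdiff : DifferentiableOn ℂ Φ (ball 0 R) := by
    intro t ht
    obtain ⟨s, hs, hs'⟩ : ∃ s ∈ 𝓝 t, s ⊆ ball 0 R ∧ ∀ y ∈ s \ {t}, u y ≠ 0 := by
      have := (hne t ht)
      rw [eventually_nhdsWithin_iff] at this
      refine ⟨_, inter_mem (isOpen_ball.mem_nhds ht) this, Set.inter_subset_left, ?_⟩
      exact fun y hy => hy.1.2 hy.2
    have key := Complex.differentiableOn_update_limUnder_of_bddAbove (f := φ) hs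
      (fun y hy => (hφ y (hs'.1 hy.1) (hs'.2 y hy)).differentiableWithinAt)
      ⟨C, by rintro _ ⟨y, hy, rfl⟩; exact hb y (hs'.1 hy.1) (hs'.2 y hy)⟩
    have := (key.differentiableAt hs).congr_of_eventuallyEq (f₁ := Φ) ?_
    · exact this.differentiableWithinAt
    · filter_upwards [hs] with y hy
      rcases eq_or_ne y t with rfl | hyt
      · simp [hΦ]
      · rw [Function.update_of_ne hyt]
        exact hval y (hs'.1 hy) (hs'.2 y ⟨hy, hyt⟩)
  have hcl : DiffContOnCl ℂ Φ (ball 0 r) :=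
    hdiff.diffContOnCl_ball (closedBall_subset_ball hrR)
  rw [← hval 0 (mem_ball_self hR) hu0,
    ← hcl.two_pi_i_inv_smul_circleIntegral_sub_inv_smul (mem_ball_self hr)]
  congr 1
  refine circleIntegral.integral_congr hr.le fun t ht => ?_
  rw [hval t (sphere_subset_closedBall.trans (closedBall_subset_ball hrR) ht) (hur t ht)]

variable {E : Type*} [NormedAddCommGroup E] [NormedSpace ℂ E]

/-- Riemann's extension theorem: a function which is holomorphic and bounded off the zeros of a
nonzero holomorphic function extends holomorphically. The extension is the Cauchy integral along a
complex line on which `u` does not vanish identically. -/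
theorem exists_analyticAt_extension {u φ : E → ℂ} {x : E} (hu : AnalyticAt ℂ u x)
    (hu0 : ¬ ∀ᶠ y in 𝓝 x, u y = 0) (hφ : ∀ᶠ y in 𝓝 x, u y ≠ 0 → AnalyticAt ℂ φ y)
    (hb : ∃ C : ℝ, ∀ᶠ y in 𝓝 x, u y ≠ 0 → ‖φ y‖ ≤ C) :
    ∃ Φ : E → ℂ, AnalyticAt ℂ Φ x ∧ ∀ᶠ y in 𝓝 x, u y ≠ 0 → Φ y = φ y := by
  obtain ⟨C, hb⟩ := hb
  obtain ⟨R, hR, hball⟩ := Metric.eventually_nhds_iff_ball.1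
    (hu.eventually_analyticAt.and (hφ.and hb))
  obtain ⟨y₁, hy₁, hy₁u⟩ : ∃ y ∈ ball x R, u y ≠ 0 := by
    by_contra! h
    exact hu0 (by filter_upwards [ball_mem_nhds x hR] with y hy using h y hy)
  set v := y₁ - x with hv
  have hvR : ‖v‖ < R := by rwa [mem_ball, dist_eq_norm] at hy₁
  have hline : ∀ y : E, AnalyticOnNhd ℂ (fun t : ℂ => y + t • v) Set.univ := fun y t _ => by
    fun_prop
  have hne : ∀ᶠ t in 𝓝[≠] (0 : ℂ), u (x + t • v) ≠ 0 := by
    have hS : Convex ℝ ((fun t : ℂ => x + t • v) ⁻¹' ball x R) := by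
      have : ((fun t : ℂ => x + t • v) ⁻¹' ball x R) =
          ((LinearMap.toSpanSingleton ℂ E v).restrictScalars ℝ) ⁻¹' ball 0 R := by
        ext t; simp
      rw [this]
      exact (convex_ball 0 R).linear_preimage _
    have hg : AnalyticOnNhd ℂ (fun t : ℂ => u (x + t • v))
        ((fun t : ℂ => x + t • v) ⁻¹' ball x R) := fun t ht =>
      AnalyticAt.comp (g := u) (hball _ ht).1 (hline x t trivial)
    refine (hg 0 (by simpa using hR)).eventually_eq_zero_or_eventually_ne_zero.resolve_left
      fun h0 => hy₁u ?_
    have := hg.eqOn_zero_of_preconnected_of_eventuallyEq_zero hS.isPreconnected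
      (by simpa using hR) h0 (show (1 : ℂ) ∈ _ by simpa using hvR)
    simpa [hv] using this
  obtain ⟨r, hr, hr1, hrne⟩ : ∃ r : ℝ, 0 < r ∧ r < 1 ∧
      ∀ t ∈ sphere (0 : ℂ) r, u (x + t • v) ≠ 0 := by
    rw [eventually_nhdsWithin_iff, Metric.eventually_nhds_iff_ball] at hne
    obtain ⟨ε, hε, h⟩ := hne
    refine ⟨min (ε / 2) (1 / 2), by positivity, by
      exact (min_le_right _ _).trans_lt (by norm_num), fun t ht => h t ?_ ?_⟩
    · rw [mem_sphere_zero_iff_norm] at ht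
      rw [mem_ball_zero_iff, ht]
      exact (min_le_left _ _).trans_lt (by linarith)
    · rintro rfl
      have : (0 : ℝ) < min (ε / 2) (1 / 2) := by positivity
      simp at ht
      linarith
  have hmem : ∀ᶠ y in 𝓝 x, ∀ t ∈ ball (0 : ℂ) 1, y + t • v ∈ ball x R := by
    filter_upwards [ball_mem_nhds x (sub_pos.2 hvR)] with y hy t ht
    rw [mem_ball, dist_eq_norm] at hy ⊢
    rw [mem_ball_zero_iff] at ht
    calc ‖y + t • v - x‖ = ‖(y - x) + t • v‖ := by congr 1; abel
      _ ≤ ‖y - x‖ + ‖t‖ * ‖v‖ := by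
        refine (norm_add_le _ _).trans ?_
        rw [norm_smul]
      _ < (R - ‖v‖) + ‖v‖ := by
        refine add_lt_add_of_lt_of_le hy ?_
        exact mul_le_of_le_one_left (norm_nonneg _) ht.le
      _ = R := by ring
  have hcircle : ∀ t ∈ sphere (0 : ℂ) r, t ∈ ball (0 : ℂ) 1 := fun t ht => by
    rw [mem_sphere_zero_iff_norm] at ht
    rw [mem_ball_zero_iff, ht]; exact hr1
  have htube : ∀ᶠ y in 𝓝 x, ∀ t ∈ sphere (0 : ℂ) r, u (y + t • v) ≠ 0 := by
    refine (isCompact_sphere (0 : ℂ) r).eventually_forall_of_forall_eventually fun t ht => ?_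
    have hc : ContinuousAt (fun p : E × ℂ => u (p.1 + p.2 • v)) (x, t) := by
      refine ContinuousAt.comp (g := u) ?_ (by fun_prop)
      exact (hball _ (hmem.self_of_nhds t (hcircle t ht))).1.continuousAt
    exact hc.eventually_ne (hrne t ht)
  refine ⟨fun y => (2 * Real.pi * Complex.I : ℂ)⁻¹ • ∮ t in C(0, r), (t - 0)⁻¹ • φ (y + t • v),
    ?_, ?_⟩
  · refine AnalyticAt.fun_const_smul ?_
    have hderiv : Continuous (fun θ => deriv (circleMap 0 r) θ) := by
      simp only [deriv_circleMap]
      fun_prop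
    have key := analyticAt_setIntegral_add (f := φ) (γ := fun θ => circleMap 0 r θ • v)
      (w := fun θ => deriv (circleMap 0 r) θ * (circleMap 0 r θ - 0)⁻¹)
      (by fun_prop) (by
        refine Continuous.mul hderiv
          (Continuous.inv₀ (by fun_prop) fun θ => ?_)
        simpa using hr.ne')
      (isCompact_Icc (a := 0) (b := 2 * Real.pi)) (x := x) fun θ _ => by
        have hθ := circleMap_mem_sphere (0 : ℂ) hr.le θ
        exact (hball _ (hmem.self_of_nhds _ (hcircle _ hθ))).2.1 (hrne _ hθ)
    convert key using 2 with y
    rw [circleIntegral, intervalIntegral.integral_of_le Real.two_pi_pos.le,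
      integral_Icc_eq_integral_Ioc]
    simp only [smul_eq_mul, mul_assoc]
  · filter_upwards [hmem, htube] with y hy hty hyu
    have := circleIntegral_eq_of_bounded_of_ne_zero (u := fun t => u (y + t • v))
      (φ := fun t => φ (y + t • v)) (C := C) hr hr1
      (fun t ht => AnalyticAt.comp (g := u) (hball _ (hy t ht)).1 (hline y t trivial)) hty (by simpa using hyu)
      (fun t ht hut => DifferentiableAt.comp (g := φ) t ((hball _ (hy t ht)).2.1 hut).differentiableAt
        (hline y t trivial).differentiableAt)
      (fun t ht hut => (hball _ (hy t ht)).2.2 hut)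
    simpa using this

end RiemannExtension

end Hartogs

end

/-! ### Holomorphic functions on manifolds and thin sets -/

section

open Metric Filter Topology

namespace Hartogs

section HolomorphicFunctions

theorem eventually_chart_symm_iff {E M : Type*} [NormedAddCommGroup E]
    [TopologicalSpace M] [ChartedSpace E M] {x : M} {p : M → Prop} :
    (∀ᶠ z in 𝓝 (chartAt E x x), p ((chartAt E x).symm z)) ↔ ∀ᶠ y in 𝓝 x, p y := by
  rw [← (chartAt E x).symm_map_nhds_eq (mem_chart_source E x)]
  rfl

variable {E : Type*} [NormedAddCommGroup E] [NormedSpace ℂ E]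
  {M : Type*} [TopologicalSpace M] [ChartedSpace E M] [IsManifold 𝓘(ℂ, E) ω M]

theorem contMDiffAt_iff_analyticAt_chart {f : M → ℂ} {x y : M} (hy : y ∈ (chartAt E x).source) :
    ContMDiffAt 𝓘(ℂ, E) 𝓘(ℂ, ℂ) ω f y ↔
      AnalyticAt ℂ (f ∘ (chartAt E x).symm) (chartAt E x y) := by
  rw [← analyticWithinAt_univ, ← contDiffWithinAt_omega_iff_analyticWithinAt,
    contDiffWithinAt_univ, ← contMDiffAt_iff_contDiffAt]
  have hy' := (chartAt E x).map_source hy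
  constructor
  · intro h
    refine ContMDiffAt.comp _ (g := f) ?_ ((contMDiffOn_chart_symm (I := 𝓘(ℂ, E)) (n := ω)
      (x := x)).contMDiffAt ((chartAt E x).open_target.mem_nhds hy'))
    rwa [(chartAt E x).left_inv hy]
  · intro h
    refine (ContMDiffAt.comp y h ((contMDiffOn_chart (I := 𝓘(ℂ, E)) (n := ω)
      (x := x)).contMDiffAt ((chartAt E x).open_source.mem_nhds hy))).congr_of_eventuallyEq ?_
    filter_upwards [(chartAt E x).open_source.mem_nhds hy] with z hz
    simp [(chartAt E x).left_inv hz]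

/-- Riemann's extension theorem on a complex manifold. -/
theorem exists_contMDiffAt_extension {u φ : M → ℂ} {x : M}
    (hu : ContMDiffAt 𝓘(ℂ, E) 𝓘(ℂ, ℂ) ω u x) (hu0 : ∃ᶠ y in 𝓝 x, u y ≠ 0)
    (hφ : ∀ᶠ y in 𝓝 x, u y ≠ 0 → ContMDiffAt 𝓘(ℂ, E) 𝓘(ℂ, ℂ) ω φ y)
    (hb : ∃ C : ℝ, ∀ᶠ y in 𝓝 x, u y ≠ 0 → ‖φ y‖ ≤ C) :
    ∃ Φ : M → ℂ, ContMDiffAt 𝓘(ℂ, E) 𝓘(ℂ, ℂ) ω Φ x ∧ ∀ᶠ y in 𝓝 x, u y ≠ 0 → Φ y = φ y := by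
  have hx := mem_chart_source E x
  obtain ⟨C, hb⟩ := hb
  obtain ⟨Φ, hΦ, h⟩ := exists_analyticAt_extension (u := u ∘ (chartAt E x).symm)
    (φ := φ ∘ (chartAt E x).symm) (x := chartAt E x x)
    ((contMDiffAt_iff_analyticAt_chart hx).1 hu)
    (fun h => hu0 ((eventually_chart_symm_iff.1 h).mono fun y hy => not_not.2 hy)) (by
      filter_upwards [eventually_chart_symm_iff.2 hφ,
        (chartAt E x).open_target.mem_nhds (mem_chart_target E x)] with z hz hzt huz
      have := (contMDiffAt_iff_analyticAt_chart (x := x) ((chartAt E x).map_target hzt)).1 (hz huz)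
      rwa [(chartAt E x).right_inv hzt] at this)
    ⟨C, eventually_chart_symm_iff.2 hb⟩
  refine ⟨Φ ∘ chartAt E x, ?_, ?_⟩
  · rw [contMDiffAt_iff_analyticAt_chart hx]
    refine hΦ.congr ?_
    filter_upwards [(chartAt E x).open_target.mem_nhds (mem_chart_target E x)] with z hz
    simp [(chartAt E x).right_inv hz]
  · have h' := ((chartAt E x).continuousAt hx).eventually h
    filter_upwards [h', (chartAt E x).open_source.mem_nhds hx] with y hy hys huy
    simp only [Function.comp_apply, (chartAt E x).left_inv hys] at hy
    exact hy huy

/-- A holomorphic function which is not identically zero near `x` is not identically zero near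
the points close to `x`. -/
theorem eventually_frequently_ne_zero {u : M → ℂ} {x : M}
    (hu : ContMDiffAt 𝓘(ℂ, E) 𝓘(ℂ, ℂ) ω u x) (hu0 : ∃ᶠ y in 𝓝 x, u y ≠ 0) :
    ∀ᶠ y in 𝓝 x, ∃ᶠ z in 𝓝 y, u z ≠ 0 := by
  have hx := mem_chart_source E x
  set e := chartAt E x with he
  have ha := ((contMDiffAt_iff_analyticAt_chart hx).1 hu).eventually_analyticAt
  obtain ⟨R, hR, hball⟩ := Metric.eventually_nhds_iff_ball.1
    (ha.and (e.open_target.mem_nhds (mem_chart_target E x)))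
  have hpre := (e.continuousAt hx).eventually (ball_mem_nhds _ hR)
  filter_upwards [hpre, e.open_source.mem_nhds hx] with y hy hys
  intro h0
  simp only [not_not] at h0
  refine hu0 (Eventually.mono ?_ fun y (hy : u y = 0) => not_not.2 hy)
  have h1 : u ∘ e.symm =ᶠ[𝓝 (e y)] 0 := by
    have := (e.symm.continuousAt (e.map_source hys)).eventually
      (p := fun z => u z = 0) (by simpa [e.left_inv hys] using h0)
    filter_upwards [this] with z hz using hz
  have h2 := AnalyticOnNhd.eqOn_zero_of_preconnected_of_eventuallyEq_zero (𝕜 := ℂ)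
    (f := u ∘ e.symm) (U := ball (e x) R) (fun z hz => (hball z hz).1)
    (convex_ball (e x) R |>.isPreconnected) hy h1
  refine (eventually_chart_symm_iff (E := E) (p := fun y => u y = 0)).1 ?_
  filter_upwards [ball_mem_nhds _ hR] with z hz using h2 hz

/-- The identity theorem on a complex manifold. -/
theorem eqOn_zero_of_isPreconnected {u : M → ℂ} {U : Set M} (hU : IsPreconnected U)
    (hu : ∀ x ∈ U, ContMDiffAt 𝓘(ℂ, E) 𝓘(ℂ, ℂ) ω u x) {x₀ : M} (hx₀ : x₀ ∈ U)
    (h₀ : ∀ᶠ y in 𝓝 x₀, u y = 0) : ∀ x ∈ U, ∀ᶠ y in 𝓝 x, u y = 0 := by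
  refine hU.subset_left_of_subset_union (u := {x | ∀ᶠ y in 𝓝 x, u y = 0})
    (v := {x | ∀ᶠ y in 𝓝 x, ∃ᶠ z in 𝓝 y, u z ≠ 0}) ?_ ?_ ?_ ?_ ⟨x₀, hx₀, h₀⟩
  · exact isOpen_setOfPred_eventually_nhds
  · exact isOpen_setOfPred_eventually_nhds
  · rw [Set.disjoint_left]
    intro x hx hx'
    exact hx'.self_of_nhds (by simpa using hx)
  · intro x hx
    by_cases h : ∀ᶠ y in 𝓝 x, u y = 0
    · exact Or.inl h
    · exact Or.inr (eventually_frequently_ne_zero (hu x hx) (by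
        simpa only [Filter.Frequently, not_not] using h))

/-- `Z` is locally contained in the zero set of a holomorphic function which is not locally zero. -/
def IsThin (E : Type*) [NormedAddCommGroup E] [NormedSpace ℂ E] {M : Type*} [TopologicalSpace M]
    [ChartedSpace E M] (Z : Set M) : Prop :=
  ∀ x : M, ∃ u : M → ℂ, ContMDiffAt 𝓘(ℂ, E) 𝓘(ℂ, ℂ) ω u x ∧ (∃ᶠ y in 𝓝 x, u y ≠ 0) ∧
    ∀ᶠ y in 𝓝 x, y ∈ Z → u y = 0

/-- A thin closed set does not disconnect a connected open set: a locally constant function on the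
complement extends holomorphically, and the extension is still locally constant. -/
theorem IsThin.isPreconnected_diff {Z : Set M} (hZ : IsThin E Z) (hZc : IsClosed Z) {V : Set M}
    (hV : IsPreconnected V) (hVo : IsOpen V) : IsPreconnected (V \ Z) := by
  classical
  rw [isPreconnected_iff_subset_of_disjoint]
  intro A B hA hB hAB hdisj
  have hVZ : IsOpen (V \ Z) := hVo.sdiff hZc
  have hnot : ∀ y ∈ V \ Z, y ∈ A → y ∈ B → False := fun y hy hyA hyB =>
    (Set.eq_empty_iff_forall_notMem.1 hdisj y) ⟨hy, hyA, hyB⟩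
  have hloc : ∀ x ∈ V, (∀ᶠ y in 𝓝 x, y ∈ V \ Z → y ∈ A) ∨ (∀ᶠ y in 𝓝 x, y ∈ V \ Z → y ∈ B) := by
    intro x hx
    obtain ⟨u, hu, hu0, huZ⟩ := hZ x
    have hxV := hVo.mem_nhds hx
    have hfreq := eventually_frequently_ne_zero hu hu0
    set f : M → ℂ := A.indicator 1 with hf
    obtain ⟨Φ, hΦ, hΦf⟩ := exists_contMDiffAt_extension (φ := f) hu hu0 (by
      filter_upwards [huZ, hxV] with y hyZ hyV huy
      have hy : y ∈ V \ Z := ⟨hyV, fun h => huy (hyZ h)⟩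
      rcases hAB hy with h | h
      · refine (contMDiffAt_const (c := (1 : ℂ))).congr_of_eventuallyEq ?_
        filter_upwards [hA.mem_nhds h] with z hz
        simp [hf, hz]
      · refine (contMDiffAt_const (c := (0 : ℂ))).congr_of_eventuallyEq ?_
        filter_upwards [hB.mem_nhds h, hVZ.mem_nhds hy] with z hz hz'
        simp [hf, show z ∉ A from fun hzA => hnot z hz' hzA hz])
      ⟨1, Eventually.of_forall fun y _ => by
        by_cases hy : y ∈ A <;> simp [hf, hy]⟩
    have hcont : ∀ᶠ y in 𝓝 x, ContinuousAt Φ y := by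
      filter_upwards [(contMDiffAt_iff_contMDiffAt_nhds (by simp)).1 hΦ] with y hy using hy.continuousAt
    have hval : ∀ᶠ y in 𝓝 x, Φ y ∈ ({0, 1} : Set ℂ) := by
      filter_upwards [hcont, hfreq, hΦf.eventually_nhds] with y hy hyu hyf
      have hcl : IsClosed ({0, 1} : Set ℂ) := (Set.toFinite _).isClosed
      refine hcl.mem_of_frequently_of_tendsto ?_ hy.tendsto
      refine (hyu.and_eventually hyf).mono fun z hz => ?_
      rw [hz.2 hz.1]
      by_cases hzA : z ∈ A <;> simp [hf, hzA]
    have hcx := hcont.self_of_nhds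
    -- the points with `u ≠ 0` near a point of `V \ Z` decide on which side it lies
    rcases hval.self_of_nhds with h0 | h1
    · right
      have hne : ∀ᶠ y in 𝓝 x, Φ y ≠ 1 := hcx.eventually_ne (by simp [h0])
      filter_upwards [(hne.and hΦf).eventually_nhds, hfreq] with y hy hyu hyVZ
      refine (hAB hyVZ).resolve_left fun hyA => ?_
      obtain ⟨z, hz, hzA, hz1, hz2⟩ := (hyu.and_eventually ((hA.eventually_mem hyA).and hy)).exists
      exact hz1 (by rw [hz2 hz]; simp [hf, show z ∈ A from hzA])
    · left
      have hne : ∀ᶠ y in 𝓝 x, Φ y ≠ 0 := hcx.eventually_ne (by simp [Set.mem_singleton_iff.1 h1])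
      filter_upwards [(hne.and hΦf).eventually_nhds, hfreq] with y hy hyu hyVZ
      refine (hAB hyVZ).resolve_right fun hyB => ?_
      obtain ⟨z, hz, ⟨hzB, hzVZ⟩, hz1, hz2⟩ := (hyu.and_eventually
        (((hB.eventually_mem hyB).and (hVZ.eventually_mem hyVZ)).and hy)).exists
      refine hz1 ?_
      rw [hz2 hz]
      simp [hf, show z ∉ A from fun hzA => hnot z hzVZ hzA hzB]
  have hdense : ∀ x ∈ V, ∃ᶠ y in 𝓝 x, y ∈ V \ Z := by
    intro x hx
    obtain ⟨u, hu, hu0, huZ⟩ := hZ x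
    exact (hu0.and_eventually (huZ.and (hVo.eventually_mem hx))).mono
      fun y hy => ⟨hy.2.2, fun h => hy.1 (hy.2.1 h)⟩
  rcases isPreconnected_iff_subset_of_disjoint.1 hV {x | ∀ᶠ y in 𝓝 x, y ∈ V \ Z → y ∈ A}
    {x | ∀ᶠ y in 𝓝 x, y ∈ V \ Z → y ∈ B} isOpen_setOfPred_eventually_nhds
    isOpen_setOfPred_eventually_nhds hloc (by
      refine Set.eq_empty_iff_forall_notMem.2 ?_
      rintro x ⟨hx, hxA, hxB⟩
      obtain ⟨y, hy, hyA, hyB⟩ := ((hdense x hx).and_eventually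
        (Filter.Eventually.and hxA hxB)).exists
      exact hnot y hy (hyA hy) (hyB hy)) with h | h
  · exact Or.inl fun y hy => (h hy.1).self_of_nhds hy
  · exact Or.inr fun y hy => (h hy.1).self_of_nhds hy

/-- A quotient `g / u` of holomorphic functions which is integral over the holomorphic functions is
holomorphic: the integral equation makes it locally bounded. -/
theorem exists_contMDiff_mul_eq [PreconnectedSpace M] {u g a : M → ℂ}
    (hu : ContMDiff 𝓘(ℂ, E) 𝓘(ℂ, ℂ) ω u) (hg : ContMDiff 𝓘(ℂ, E) 𝓘(ℂ, ℂ) ω g)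
    (ha : Continuous a) (hu0 : u ≠ 0) {P : Polynomial ℂ} (hP : 0 < P.degree)
    (h : ∀ y, u y ≠ 0 → P.eval (g y / u y) = a y) :
    ∃ F : M → ℂ, ContMDiff 𝓘(ℂ, E) 𝓘(ℂ, ℂ) ω F ∧ ∀ y, u y * F y = g y := by
  have hu0' : ∀ x, ∃ᶠ y in 𝓝 x, u y ≠ 0 := by
    intro x hx
    simp only [not_not] at hx
    refine hu0 (funext fun y => ?_)
    exact (eqOn_zero_of_isPreconnected isPreconnected_univ
      (fun x _ => hu x) (Set.mem_univ x) hx y (Set.mem_univ y)).self_of_nhds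
  set φ : M → ℂ := fun y => g y / u y with hφ
  set F : M → ℂ := fun x => limUnder (𝓝[{y | u y ≠ 0}] x) φ with hF
  have key : ∀ x, ContMDiffAt 𝓘(ℂ, E) 𝓘(ℂ, ℂ) ω F x ∧ ∀ᶠ y in 𝓝 x, u y ≠ 0 → F y = φ y := by
    intro x
    obtain ⟨Φ, hΦ, hΦφ⟩ := exists_contMDiffAt_extension (φ := φ) (hu x) (hu0' x)
      (Eventually.of_forall fun y hy => (hg y).div₀ (hu y) hy) (by
        have hbd : ∀ᶠ y in 𝓝 x, ‖a y‖ < ‖a x‖ + 1 :=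
          ha.norm.continuousAt.eventually_lt continuousAt_const (by simp)
        have ht := Polynomial.tendsto_norm_atTop P hP (l := Bornology.cobounded ℂ) (z := id)
          tendsto_norm_cobounded_atTop
        obtain ⟨C, hC⟩ := (Metric.hasBasis_cobounded_compl_closedBall (0 : ℂ)).eventually_iff.1
          (ht.eventually_ge_atTop (‖a x‖ + 1))
        refine ⟨C, ?_⟩
        filter_upwards [hbd] with y hy huy
        by_contra hlt
        have := hC.2 (show φ y ∈ _ by simpa using hlt)
        rw [id, h y huy] at this
        linarith)
    have hcont : ∀ᶠ y in 𝓝 x, ContinuousAt Φ y := by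
      filter_upwards [(contMDiffAt_iff_contMDiffAt_nhds (by simp)).1 hΦ] with y hy using hy.continuousAt
    have hFΦ : ∀ᶠ y in 𝓝 x, F y = Φ y := by
      filter_upwards [hcont, hΦφ.eventually_nhds] with y hy hyφ
      have hne : (𝓝[{y | u y ≠ 0}] y).NeBot := by
        rw [← mem_closure_iff_nhdsWithin_neBot, mem_closure_iff_frequently]
        exact hu0' y
      refine Tendsto.limUnder_eq ?_
      refine (hy.tendsto.mono_left nhdsWithin_le_nhds).congr' ?_
      exact eventually_nhdsWithin_iff.2 (hyφ.mono fun z hz hz' => hz hz')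
    refine ⟨hΦ.congr_of_eventuallyEq hFΦ, ?_⟩
    filter_upwards [hFΦ, hΦφ] with y h1 h2 h3
    rw [h1, h2 h3]
  have hFs : ContMDiff 𝓘(ℂ, E) 𝓘(ℂ, ℂ) ω F := fun x => (key x).1
  refine ⟨F, hFs, fun y => ?_⟩
  have hcl : IsClosed {y | u y * F y = g y} :=
    isClosed_eq (hu.continuous.mul hFs.continuous) hg.continuous
  change y ∈ {y | u y * F y = g y}
  refine hcl.mem_of_frequently_of_tendsto (f := id) ?_ (tendsto_id (x := 𝓝 y))
  refine Frequently.mono (hu0' y) fun z hz => ?_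
  change u z * F z = g z
  rw [(key z).2.self_of_nhds hz, hφ]
  field_simp

end HolomorphicFunctions

end Hartogs

end

/-! ### Restriction maps of finite codimension -/

section

open Filter Topology Polynomial

namespace Hartogs

section FiniteCodimension

theorem exists_algebraMap_eq_of_isIntegral {B : Type*} [CommRing B] [IsDomain B] [Algebra ℂ B]
    {x : B} (hx : IsIntegral ℂ x) : ∃ c : ℂ, algebraMap ℂ B c = x := by
  obtain ⟨c, hc⟩ := (IsAlgClosed.algebraMap_bijective_of_isIntegral
    (k := ℂ) (K := integralClosure ℂ B)).2 ⟨x, hx⟩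
  exact ⟨c, congrArg Subtype.val hc⟩

/-- If `A ⊆ B` are `ℂ`-algebras, `B` is a domain and `B / A` is finite dimensional, then every
element of `B` is a quotient `g / u` of elements of `A` and is integral over `A`. The integral
equation `P(g / u) = a` is written without denominators. -/
theorem exists_integral_quotient {A B : Type*} [CommRing A] [CommRing B] [IsDomain B]
    [Algebra ℂ A] [Algebra ℂ B] [Algebra A B] [IsScalarTower ℂ A B]
    (hinj : Function.Injective (algebraMap A B))
    [FiniteDimensional ℂ (B ⧸ LinearMap.range (Algebra.linearMap A B))] (f : B) :
    f ∈ Set.range (algebraMap A B) ∨ ∃ (u g a : A) (P : ℂ[X]), u ≠ 0 ∧ 0 < P.degree ∧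
      algebraMap A B u * f = algebraMap A B g ∧
      ((P.map (algebraMap ℂ A)).scaleRoots u).eval g =
        u ^ (P.map (algebraMap ℂ A)).natDegree * a := by
  set W := LinearMap.range (Algebra.linearMap A B) with hW
  obtain ⟨P, a, hP, ha⟩ : ∃ (P : ℂ[X]) (a : A), 0 < P.degree ∧ aeval f P = algebraMap A B a := by
    let L : ℂ[X] →ₗ[ℂ] (B ⧸ W) := (W.mkQ.restrictScalars ℂ) ∘ₗ (aeval f).toLinearMap ∘ₗ
      LinearMap.mulLeft ℂ (X : ℂ[X])
    have hL : ¬ Function.Injective L := fun h =>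
      Polynomial.not_finite (R := ℂ) (Module.Finite.of_injective L h)
    obtain ⟨p, hp, hp0⟩ : ∃ p, L p = 0 ∧ p ≠ 0 := by
      by_contra! hcon
      exact hL ((injective_iff_map_eq_zero L).2 hcon)
    have : aeval f (X * p) ∈ W := (Submodule.Quotient.mk_eq_zero W).1 hp
    obtain ⟨a, ha⟩ := this
    refine ⟨X * p, a, ?_, ha.symm⟩
    rw [mul_comm, degree_mul_X, degree_eq_natDegree hp0]
    exact_mod_cast Nat.succ_pos _
  by_cases hA : ∀ x : A, IsIntegral ℂ x
  · -- every element of `A`, hence `f`, is a constant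
    left
    have h1 : IsIntegral ℂ (algebraMap A B a) := (hA a).map (IsScalarTower.toAlgHom ℂ A B)
    obtain ⟨c, hc⟩ := exists_algebraMap_eq_of_isIntegral h1
    have h2 : IsIntegral ℂ f := by
      rw [← isAlgebraic_iff_isIntegral]
      refine ⟨P - C c, fun h => ?_, by simp [ha, hc]⟩
      have h3 := congrArg degree h
      rw [degree_sub_C hP, degree_zero] at h3
      rw [h3] at hP
      exact absurd hP (by simp)
    obtain ⟨d, hd⟩ := exists_algebraMap_eq_of_isIntegral h2
    exact ⟨algebraMap ℂ A d, by rw [← hd, ← IsScalarTower.algebraMap_apply]⟩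
  · -- a polynomial in a nonconstant `h : A` kills `B / A`
    right
    push Not at hA
    obtain ⟨h, hh⟩ := hA
    obtain ⟨p, hp, hp0⟩ := Algebra.IsIntegral.isIntegral (R := ℂ) (Algebra.lsmul ℂ ℂ (B ⧸ W) h)
    have hp0' : Algebra.lsmul ℂ ℂ (B ⧸ W) (aeval h p) = 0 := by
      rw [← aeval_algHom_apply]
      exact hp0
    have hmem : algebraMap A B (aeval h p) * f ∈ W := by
      have := LinearMap.congr_fun hp0' (W.mkQ f)
      rw [← Algebra.smul_def, ← Submodule.Quotient.mk_eq_zero]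
      exact this
    obtain ⟨g, hg⟩ := hmem
    refine ⟨aeval h p, g, a, P, fun h0 => ?_, hP, hg.symm, ?_⟩
    · exact hh ⟨p, hp, h0⟩
    · apply hinj
      have hg' : algebraMap A B g = algebraMap A B (aeval h p) * f := hg
      rw [← eval₂_at_apply, hg', scaleRoots_eval₂_mul, map_mul, map_pow, eval₂_map,
        ← IsScalarTower.algebraMap_eq, ← ha]
      rfl

end FiniteCodimension

section ExtendHolomorphic

variable {E : Type*} [NormedAddCommGroup E] [NormedSpace ℂ E]
  {M : Type*} [TopologicalSpace M] [ChartedSpace E M]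

instance isDomain_contMDiffMap [IsManifold 𝓘(ℂ, E) ω M] [ConnectedSpace M] :
    IsDomain C^ω⟮𝓘(ℂ, E), M; 𝓘(ℂ, ℂ), ℂ⟯ := by
  have : Nontrivial C^ω⟮𝓘(ℂ, E), M; 𝓘(ℂ, ℂ), ℂ⟯ := by
    obtain ⟨x⟩ := (inferInstance : Nonempty M)
    exact ⟨0, 1, fun h => zero_ne_one (α := ℂ) (congrArg (fun f => f x) h)⟩
  have : NoZeroDivisors C^ω⟮𝓘(ℂ, E), M; 𝓘(ℂ, ℂ), ℂ⟯ := by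
    refine ⟨fun {f g} hfg => or_iff_not_imp_left.2 fun hf => ?_⟩
    obtain ⟨x, hx⟩ : ∃ x, f x ≠ 0 := by
      by_contra! h
      exact hf (ContMDiffMap.ext h)
    ext y
    refine (eqOn_zero_of_isPreconnected isPreconnected_univ (u := g)
      (fun z _ => g.contMDiff z) (Set.mem_univ x) ?_ y (Set.mem_univ y)).self_of_nhds
    filter_upwards [f.contMDiff.continuous.continuousAt.eventually_ne hx] with z hz
    exact (mul_eq_zero.1 (congrArg (fun f => f z) hfg)).resolve_left hz
  exact NoZeroDivisors.to_isDomain _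

variable (E) in
/-- Restriction of holomorphic functions to an open subset, as a homomorphism of algebras. -/
noncomputable def restrictHolAlgHom (U : Opens M) : C^ω⟮𝓘(ℂ, E), M; 𝓘(ℂ, ℂ), ℂ⟯ →ₐ[ℂ]
    C^ω⟮𝓘(ℂ, E), U; 𝓘(ℂ, ℂ), ℂ⟯ where
  toFun f := ⟨f ∘ Subtype.val, f.contMDiff.comp contMDiff_subtype_val⟩
  map_one' := rfl
  map_mul' _ _ := rfl
  map_zero' := rfl
  map_add' _ _ := rfl
  commutes' _ := rfl

/-- If restriction to a connected open subset has finite dimensional cokernel on holomorphic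
functions, then it is surjective. -/
theorem restrictHolAlgHom_surjective [IsManifold 𝓘(ℂ, E) ω M] [PreconnectedSpace M] {U : Opens M}
    (hU : IsConnected (U : Set M))
    (hfin : FiniteDimensional ℂ (C^ω⟮𝓘(ℂ, E), U; 𝓘(ℂ, ℂ), ℂ⟯ ⧸
      LinearMap.range (restrictHolAlgHom E U).toLinearMap)) :
    Function.Surjective (restrictHolAlgHom E U) := by
  have : ConnectedSpace U := isConnected_iff_connectedSpace.1 hU
  let _ : Algebra C^ω⟮𝓘(ℂ, E), M; 𝓘(ℂ, ℂ), ℂ⟯ C^ω⟮𝓘(ℂ, E), U; 𝓘(ℂ, ℂ), ℂ⟯ :=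
    (restrictHolAlgHom E U).toRingHom.toAlgebra
  have : IsScalarTower ℂ C^ω⟮𝓘(ℂ, E), M; 𝓘(ℂ, ℂ), ℂ⟯ C^ω⟮𝓘(ℂ, E), U; 𝓘(ℂ, ℂ), ℂ⟯ :=
    IsScalarTower.of_algebraMap_eq' rfl
  have hinj : Function.Injective (algebraMap C^ω⟮𝓘(ℂ, E), M; 𝓘(ℂ, ℂ), ℂ⟯
      C^ω⟮𝓘(ℂ, E), U; 𝓘(ℂ, ℂ), ℂ⟯) := by
    rw [injective_iff_map_eq_zero]
    intro f hf
    obtain ⟨x, hx⟩ := hU.nonempty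
    ext y
    refine (eqOn_zero_of_isPreconnected isPreconnected_univ (u := f)
      (fun z _ => f.contMDiff z) (Set.mem_univ x) ?_ y (Set.mem_univ y)).self_of_nhds
    filter_upwards [U.isOpen.mem_nhds hx] with z hz
    exact congrArg (fun g => g ⟨z, hz⟩) hf
  have : FiniteDimensional ℂ (C^ω⟮𝓘(ℂ, E), U; 𝓘(ℂ, ℂ), ℂ⟯ ⧸ LinearMap.range
      (Algebra.linearMap C^ω⟮𝓘(ℂ, E), M; 𝓘(ℂ, ℂ), ℂ⟯ C^ω⟮𝓘(ℂ, E), U; 𝓘(ℂ, ℂ), ℂ⟯)) := hfin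
  intro f
  rcases exists_integral_quotient hinj f with h | ⟨u, g, a, P, hu, hP, hug, heq⟩
  · exact h
  · obtain ⟨F, hF, huF⟩ := exists_contMDiff_mul_eq u.contMDiff g.contMDiff a.contMDiff.continuous
      (fun h => hu (ContMDiffMap.ext fun x => congrFun h x)) hP (fun y hy => by
        have h1 := congrArg (ContMDiffMap.evalRingHom y) heq
        have h2 : ContMDiffMap.evalRingHom y g = u y * (g y / u y) :=
          (mul_div_cancel₀ (g y) hy).symm
        rw [← eval₂_at_apply, h2, map_mul, map_pow] at h1
        erw [scaleRoots_eval₂_mul] at h1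
        have h3 := mul_left_cancel₀ (pow_ne_zero _ hy) h1
        rw [eval₂_map] at h3
        exact h3)
    refine ⟨⟨F, hF⟩, ?_⟩
    have hu' : algebraMap C^ω⟮𝓘(ℂ, E), M; 𝓘(ℂ, ℂ), ℂ⟯ C^ω⟮𝓘(ℂ, E), U; 𝓘(ℂ, ℂ), ℂ⟯ u ≠ 0 :=
      fun h => hu (hinj (h.trans (map_zero _).symm))
    refine mul_left_cancel₀ hu' (Eq.trans ?_ hug.symm)
    ext y
    exact huF y

end ExtendHolomorphic

end Hartogs

end

/-! ### Sections, stalks and sheaves of discontinuous families -/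

noncomputable section

open TopCat Limits

namespace Hartogs

section Sections

variable {X : TopCat.{0}}

/-- Restriction of sections, as a linear map. -/
def res (F : TopCat.Sheaf (ModuleCat.{0} ℂ) X) {U V : Opens X} (h : U ≤ V) :
    F.presheaf.obj (op V) →ₗ[ℂ] F.presheaf.obj (op U) :=
  (F.presheaf.map (homOfLE h).op).hom

/-- A morphism of sheaves on sections, as a linear map. -/
def app {F G : TopCat.Sheaf (ModuleCat.{0} ℂ) X} (φ : F ⟶ G) (U : Opens X) :
    F.presheaf.obj (op U) →ₗ[ℂ] G.presheaf.obj (op U) :=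
  (φ.1.app (op U)).hom

variable {F G H : TopCat.Sheaf (ModuleCat.{0} ℂ) X}

theorem res_self {U : Opens X} (h : U ≤ U) (s : F.presheaf.obj (op U)) : res F h s = s :=
  LinearMap.congr_fun (congrArg ModuleCat.Hom.hom (F.presheaf.map_id (op U))) s

theorem res_res {U V W : Opens X} (h : U ≤ V) (h' : V ≤ W) (s : F.presheaf.obj (op W)) :
    res F h (res F h' s) = res F (h.trans h') s :=
  (LinearMap.congr_fun (congrArg ModuleCat.Hom.hom
    (F.presheaf.map_comp (homOfLE h').op (homOfLE h).op)) s).symm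

theorem app_res (φ : F ⟶ G) {U V : Opens X} (h : U ≤ V) (s : F.presheaf.obj (op V)) :
    app φ U (res F h s) = res G h (app φ V s) :=
  LinearMap.congr_fun (congrArg ModuleCat.Hom.hom (φ.1.naturality (homOfLE h).op)) s

theorem app_comp (φ : F ⟶ G) (ψ : G ⟶ H) (U : Opens X) (s : F.presheaf.obj (op U)) :
    app (φ ≫ ψ) U s = app ψ U (app φ U s) := rfl

theorem app_id (U : Opens X) (s : F.presheaf.obj (op U)) : app (𝟙 F) U s = s := rfl

theorem app_zero (U : Opens X) (s : F.presheaf.obj (op U)) : app (0 : F ⟶ G) U s = 0 := rfl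

theorem hom_ext_app {φ ψ : F ⟶ G} (h : ∀ U s, app φ U s = app ψ U s) : φ = ψ := by
  apply ObjectProperty.hom_ext
  ext U s
  exact h U.unop s

theorem germ_res {U V : Opens X} (h : U ≤ V) {x : X} (hx : x ∈ U) (s : F.presheaf.obj (op V)) :
    (F.presheaf.germ U x hx).hom (res F h s) = (F.presheaf.germ V x (h hx)).hom s :=
  LinearMap.congr_fun (congrArg ModuleCat.Hom.hom (F.presheaf.germ_res (homOfLE h) x hx)) s

theorem stalkMap_germ (φ : F ⟶ G) {U : Opens X} {x : X} (hx : x ∈ U) (s : F.presheaf.obj (op U)) :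
    ((Presheaf.stalkFunctor (ModuleCat.{0} ℂ) x).map φ.1).hom ((F.presheaf.germ U x hx).hom s) =
      (G.presheaf.germ U x hx).hom (app φ U s) :=
  LinearMap.congr_fun (congrArg ModuleCat.Hom.hom
    (Presheaf.stalkFunctor_map_germ U x hx φ.1)) s

theorem exists_res_eq_of_germ_eq {U V : Opens X} {x : X} (hU : x ∈ U) (hV : x ∈ V)
    {s : F.presheaf.obj (op U)} {t : F.presheaf.obj (op V)}
    (h : (F.presheaf.germ U x hU).hom s = (F.presheaf.germ V x hV).hom t) :
    ∃ (W : Opens X) (hWU : W ≤ U) (hWV : W ≤ V), x ∈ W ∧ res F hWU s = res F hWV t := by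
  obtain ⟨W, hxW, iU, iV, h⟩ := F.presheaf.germ_eq x hU hV s t h
  exact ⟨W, leOfHom iU, leOfHom iV, hxW, h⟩

theorem exists_germ_eq {x : X} (t : F.presheaf.stalk x) :
    ∃ (U : Opens X) (hx : x ∈ U) (s : F.presheaf.obj (op U)),
      (F.presheaf.germ U x hx).hom s = t := by
  obtain ⟨U, hx, s, hs⟩ := Presheaf.exists_germ_eq F.presheaf t
  exact ⟨U, hx, s, hs⟩

/-- Sections agreeing locally are equal. -/
theorem eq_of_locally_eq {U : Opens X} {s t : F.presheaf.obj (op U)}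
    (h : ∀ x ∈ U, ∃ (W : Opens X) (hW : W ≤ U), x ∈ W ∧ res F hW s = res F hW t) : s = t := by
  refine Presheaf.section_ext F U s t fun x hx => ?_
  obtain ⟨W, hW, hxW, h⟩ := h x hx
  exact Presheaf.germ_ext F.presheaf W hxW (homOfLE hW) (homOfLE hW) h

/-- Sections over two open sets which agree on the intersection glue. -/
theorem exists_glue {U V W : Opens X} (hU : U ≤ W) (hV : V ≤ W) (hW : W ≤ U ⊔ V)
    (s : F.presheaf.obj (op U)) (t : F.presheaf.obj (op V))
    (h : res F (inf_le_left : U ⊓ V ≤ U) s = res F inf_le_right t) :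
    ∃ r : F.presheaf.obj (op W), res F hU r = s ∧ res F hV r = t := by
  let 𝒰 : Bool → Opens X := fun b => cond b U V
  let sf : ∀ b, F.presheaf.obj (op (𝒰 b)) := fun b => match b with
    | true => s
    | false => t
  have hle : ∀ b, 𝒰 b ≤ W := fun b => match b with
    | true => hU
    | false => hV
  obtain ⟨r, hr, -⟩ := F.existsUnique_gluing' 𝒰 W (fun b => homOfLE (hle b))
    (hW.trans (sup_le (le_iSup 𝒰 true) (le_iSup 𝒰 false))) sf (by
      intro i j
      match i, j with
      | true, true => rfl
      | false, false => rfl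
      | true, false => exact h
      | false, true =>
        change res F (inf_le_left : V ⊓ U ≤ V) t = res F inf_le_right s
        have := congrArg (res F (inf_comm V U).le) h
        rw [res_res, res_res] at this
        exact this.symm)
  exact ⟨r, hr true, hr false⟩

/-- Two sections agree on a largest open set, the set of points near which they agree. -/
theorem exists_maximal_eq {U : Opens X} (s t : F.presheaf.obj (op U)) :
    ∃ (W : Opens X) (hW : W ≤ U), res F hW s = res F hW t ∧
      ∀ (W' : Opens X) (hW' : W' ≤ U), res F hW' s = res F hW' t → W' ≤ W := by
  let W : Opens X := sSup {W' | ∃ hW' : W' ≤ U, res F hW' s = res F hW' t}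
  have hW : W ≤ U := sSup_le fun W' h => h.1
  refine ⟨W, hW, eq_of_locally_eq fun x hx => ?_, fun W' hW' h => le_sSup ⟨hW', h⟩⟩
  obtain ⟨W', ⟨hW', h⟩, hxW'⟩ := Opens.mem_sSup.1 hx
  have hle : W' ≤ W := le_sSup ⟨hW', h⟩
  exact ⟨W', hle, hxW', by rw [res_res, res_res, h]⟩

theorem app_injective_of_mono (φ : F ⟶ G) [Mono φ] (U : Opens X) :
    Function.Injective (app φ U) := by
  have : ∀ x, Function.Injective ((Presheaf.stalkFunctor (ModuleCat.{0} ℂ) x).map φ.1) :=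
    fun x => (ModuleCat.mono_iff_injective _).1 (Presheaf.stalk_mono_of_mono φ x)
  exact (Presheaf.app_injective_iff_stalkFunctor_map_injective φ.1).1 this U

theorem mono_of_app_injective (φ : F ⟶ G) (h : ∀ U, Function.Injective (app φ U)) : Mono φ := by
  refine ⟨fun {K} α β hαβ => hom_ext_app fun U s => h U ?_⟩
  rw [← app_comp, ← app_comp, hαβ]

end Sections

section PiSheaf

variable {X : TopCat.{0}}

/-- The sheaf of all (discontinuous) families `(v_x)_{x ∈ U}` with `v_x ∈ V x`. -/
def piSheaf (V : X → ModuleCat.{0} ℂ) : TopCat.Sheaf (ModuleCat.{0} ℂ) X where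
  obj :=
    { obj := fun U => ModuleCat.of ℂ (∀ x : (unop U : Opens X), V x)
      map := fun {U W} h => ModuleCat.ofHom (LinearMap.pi fun x : (unop W : Opens X) =>
        (LinearMap.proj (⟨x.1, leOfHom h.unop x.2⟩ : (unop U : Opens X)) :
          (∀ x : (unop U : Opens X), V x) →ₗ[ℂ] V x.1))
      map_id := fun _ => rfl
      map_comp := fun _ _ => rfl }
  property := by
    rw [CategoryTheory.Presheaf.isSheaf_iff_isSheaf_forget _ _ (forget (ModuleCat.{0} ℂ))]
    exact TopCat.Presheaf.toTypes_isSheaf X fun x => V x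

variable {G : TopCat.Sheaf (ModuleCat.{0} ℂ) X} {V : X → ModuleCat.{0} ℂ}

variable (V) in
/-- Sections of `piSheaf V` are families. -/
def piSheafEquiv (U : Opens X) : (piSheaf V).presheaf.obj (op U) ≃ₗ[ℂ] ∀ x : U, V x :=
  LinearEquiv.refl ℂ _

theorem piSheaf_ext {U : Opens X} {s t : (piSheaf V).presheaf.obj (op U)}
    (h : ∀ x, piSheafEquiv V U s x = piSheafEquiv V U t x) : s = t :=
  (piSheafEquiv V U).injective (funext h)

/-- The morphism of sheaves given by linear maps on the stalks. -/
def toPiSheaf (ψ : ∀ x, G.presheaf.stalk x ⟶ V x) : G ⟶ piSheaf V :=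
  ⟨{ app := fun U => ModuleCat.ofHom ((piSheafEquiv V (unop U)).symm.toLinearMap ∘ₗ
      (LinearMap.pi fun x : (unop U : Opens X) =>
        (ψ x).hom ∘ₗ (G.presheaf.germ (unop U) x.1 x.2).hom))
     naturality := fun U W h => by
      ext s
      refine piSheaf_ext fun x => ?_
      exact congrArg (ψ x.1).hom (germ_res (leOfHom h.unop) x.2 s) }⟩

/-- A morphism to `piSheaf V` factors on stalks through linear maps to the `V x`. -/
def stalkToPi (φ : G ⟶ piSheaf V) (x : X) : G.presheaf.stalk x ⟶ V x :=
  colimit.desc ((OpenNhds.inclusion x).op ⋙ G.presheaf)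
    { pt := V x
      ι :=
        { app := fun U => ModuleCat.ofHom
            ((LinearMap.proj (⟨x, U.unop.2⟩ : U.unop.1) : (∀ y : U.unop.1, V y) →ₗ[ℂ] V x) ∘ₗ
              (piSheafEquiv V U.unop.1).toLinearMap ∘ₗ app φ U.unop.1)
          naturality := fun U W h => by
            ext s
            exact congrArg (fun t => piSheafEquiv V W.unop.1 t ⟨x, W.unop.2⟩)
              (app_res φ (U := W.unop.1) (V := U.unop.1) (leOfHom h.unop) s) } }

theorem stalkToPi_germ (φ : G ⟶ piSheaf V) {U : Opens X} (x : U) (s : G.presheaf.obj (op U)) :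
    (stalkToPi φ x).hom ((G.presheaf.germ U x.1 x.2).hom s) = piSheafEquiv V U (app φ U s) x := by
  have : G.presheaf.germ U x.1 x.2 ≫ stalkToPi φ x = _ :=
    colimit.ι_desc (F := (OpenNhds.inclusion x.1).op ⋙ G.presheaf) _
      (op (⟨U, x.2⟩ : OpenNhds x.1))
  exact LinearMap.congr_fun (congrArg ModuleCat.Hom.hom this) s

/-- Sheaves of discontinuous families of vectors are injective, because vector spaces are. -/
instance injective_piSheaf (V : X → ModuleCat.{0} ℂ) : Injective (piSheaf V) where
  factors {G' G} g m _ := by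
    have hm : ∀ x, ∃ ρ : G.presheaf.stalk x →ₗ[ℂ] G'.presheaf.stalk x,
        ρ ∘ₗ ((Presheaf.stalkFunctor (ModuleCat.{0} ℂ) x).map m.1).hom = LinearMap.id := fun x =>
      LinearMap.exists_leftInverse_of_injective _ (LinearMap.ker_eq_bot.2
        ((ModuleCat.mono_iff_injective _).1 (Presheaf.stalk_mono_of_mono m x)))
    choose ρ hρ using hm
    refine ⟨toPiSheaf fun x => ModuleCat.ofHom (ρ x) ≫ stalkToPi g x, hom_ext_app fun U s => ?_⟩
    refine piSheaf_ext fun x => ?_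
    rw [app_comp]
    refine Eq.trans ?_ (stalkToPi_germ g x s)
    refine congrArg (stalkToPi g x).hom ?_
    refine Eq.trans (congrArg (ρ x) (stalkMap_germ m x.2 s).symm) ?_
    exact LinearMap.congr_fun (hρ x) _

instance mono_toPiSheaf_id (G : TopCat.Sheaf (ModuleCat.{0} ℂ) X) :
    Mono (toPiSheaf (G := G) (V := fun x => G.presheaf.stalk x) fun _ => 𝟙 _) := by
  refine mono_of_app_injective _ fun U s t h => Presheaf.section_ext G U s t fun x hx => ?_
  exact congrArg (fun r => piSheafEquiv _ U r ⟨x, hx⟩) h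

/-- An injective sheaf is a retract of the sheaf of discontinuous families of its germs. -/
def retractPiSheaf (I : TopCat.Sheaf (ModuleCat.{0} ℂ) X) [Injective I] :
    Retract I (piSheaf fun x => I.presheaf.stalk x) where
  i := toPiSheaf fun _ => 𝟙 _
  r := Injective.factorThru (𝟙 I) (toPiSheaf fun _ => 𝟙 _)
  retract := Injective.comp_factorThru _ _

/-- Injective sheaves are flasque. -/
theorem exists_res_eq_of_injective (I : TopCat.Sheaf (ModuleCat.{0} ℂ) X) [Injective I]
    {U W : Opens X} (h : U ≤ W) (s : I.presheaf.obj (op U)) :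
    ∃ t : I.presheaf.obj (op W), res I h t = s := by
  classical
  let R := retractPiSheaf I
  let v : ∀ x : U, I.presheaf.stalk x.1 := piSheafEquiv _ U (app R.i U s)
  let w : ∀ x : W, I.presheaf.stalk x.1 := fun x => if hx : x.1 ∈ U then v ⟨x.1, hx⟩ else 0
  refine ⟨app R.r W ((piSheafEquiv _ W).symm w), ?_⟩
  rw [← app_res]
  have hw : res (piSheaf fun x => I.presheaf.stalk x) h ((piSheafEquiv _ W).symm w) = app R.i U s := by
    refine piSheaf_ext fun x => ?_
    change w ⟨x.1, h x.2⟩ = v x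
    simp [w]
  rw [hw, ← app_comp, R.retract, app_id]

end PiSheaf

end Hartogs

end

/-! ### Sections of inverse images -/

noncomputable section

open TopCat Limits

namespace Hartogs

section InverseImageSections

variable {X : Type} [TopologicalSpace X] (A : Set X)
  (F : TopCat.Sheaf (ModuleCat.{0} ℂ) (TopCat.of X))

/-- The trace on `A` of an open set of `X`. -/
abbrev trace (U : Opens (TopCat.of X)) : Opens (TopCat.of A) := (Opens.map (incl A)).obj U

theorem trace_mono {U V : Opens (TopCat.of X)} (h : U ≤ V) : trace A U ≤ trace A V :=
  fun _ hx => h hx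

theorem top_le_trace {U : Opens (TopCat.of X)} (hU : A ⊆ U) :
    (⊤ : Opens (TopCat.of A)) ≤ trace A U := fun a _ => hU a.2

/-- The unit `F → j_* j⁻¹F` on sections, as a linear map. -/
def unitSec (U : Opens (TopCat.of X)) :
    F.presheaf.obj (op U) →ₗ[ℂ] (inverseImage A F).presheaf.obj (op (trace A U)) :=
  (((TopCat.Sheaf.pullbackPushforwardAdjunction (ModuleCat.{0} ℂ) (incl A)).unit.app F).1.app
    (op U)).hom

variable {A F}

theorem unitSec_res {U V : Opens (TopCat.of X)} (h : U ≤ V) (s : F.presheaf.obj (op V)) :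
    unitSec A F U (res F h s) = res (inverseImage A F) (trace_mono A h) (unitSec A F V s) :=
  app_res ((TopCat.Sheaf.pullbackPushforwardAdjunction (ModuleCat.{0} ℂ) (incl A)).unit.app F) h s

theorem toSectionsOn_apply (U : Opens (TopCat.of X)) (hU : A ⊆ U) (s : F.presheaf.obj (op U)) :
    (toSectionsOn A F U hU).hom s =
      res (inverseImage A F) (top_le_trace A hU)
        (unitSec A F U s) := rfl

theorem toSectionsOn_res {U V : Opens (TopCat.of X)} (h : U ≤ V) (hU : A ⊆ U)
    (s : F.presheaf.obj (op V)) : (toSectionsOn A F U hU).hom (res F h s) =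
      (toSectionsOn A F V (hU.trans h)).hom s := by
  rw [toSectionsOn_apply, toSectionsOn_apply, unitSec_res, res_res]

/-- The morphism `F → j_* P`, where `P` is the sheaf of discontinuous families of germs of `F`
at the points of `A`. -/
def germsOn (A : Set X) (F : TopCat.Sheaf (ModuleCat.{0} ℂ) (TopCat.of X)) :
    F ⟶ (TopCat.Sheaf.pushforward (ModuleCat.{0} ℂ) (incl A)).obj
      (piSheaf (X := TopCat.of A) fun z => F.presheaf.stalk z.1) :=
  ⟨{ app := fun U => ModuleCat.ofHom
      ((piSheafEquiv (X := TopCat.of A) (fun z => F.presheaf.stalk z.1)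
        (trace A (unop U))).symm.toLinearMap ∘ₗ
      (LinearMap.pi fun z : trace A (unop U) => (F.presheaf.germ (unop U) z.1.1 z.2).hom))
     naturality := fun U W h => by
      ext s
      refine (piSheafEquiv (X := TopCat.of A) (fun z => F.presheaf.stalk z.1)
        (trace A (unop W))).injective (funext fun z => ?_)
      exact germ_res (leOfHom h.unop) z.2 s }⟩

/-- The unit `F → j_* j⁻¹F` is injective on germs: the family of germs of a section of `F` at the
points of `A` factors through it. -/
theorem germ_eq_zero_of_unitSec_eq_zero {U : Opens (TopCat.of X)} {s : F.presheaf.obj (op U)}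
    (hs : unitSec A F U s = 0) (z : A) (hz : z.1 ∈ U) :
    (F.presheaf.germ U z.1 hz).hom s = 0 := by
  let adj := TopCat.Sheaf.pullbackPushforwardAdjunction (ModuleCat.{0} ℂ) (incl A)
  have h := (adj.homEquiv _ _).apply_symm_apply (germsOn A F)
  rw [Adjunction.homEquiv_unit] at h
  have h2 : app (germsOn A F) U s = app (((adj.homEquiv _ _).symm (germsOn A F))) (trace A U)
      (unitSec A F U s) := by
    conv_lhs => rw [← h]
    rfl
  have h3 : app (germsOn A F) U s = 0 := h2.trans ((congrArg _ hs).trans (map_zero _))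
  exact congrArg (fun t => piSheafEquiv (X := TopCat.of A) (fun z => F.presheaf.stalk z.1)
    (trace A U) t ⟨z, hz⟩) h3

/-- The map `F_z → (j⁻¹F)_z` on stalks induced by the unit. -/
def stalkUnit (A : Set X) (F : TopCat.Sheaf (ModuleCat.{0} ℂ) (TopCat.of X)) (z : TopCat.of A) :
    F.presheaf.stalk (incl A z) ⟶ (inverseImage A F).presheaf.stalk z :=
  (Presheaf.stalkFunctor (ModuleCat.{0} ℂ) (incl A z)).map
    ((TopCat.Sheaf.pullbackPushforwardAdjunction (ModuleCat.{0} ℂ) (incl A)).unit.app F).1 ≫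
  Presheaf.stalkPushforward (ModuleCat.{0} ℂ) (incl A) (inverseImage A F).presheaf z

theorem stalkUnit_germ (z : TopCat.of A) {U : Opens (TopCat.of X)} (hz : incl A z ∈ U)
    (s : F.presheaf.obj (op U)) :
    (stalkUnit A F z).hom ((F.presheaf.germ U (incl A z) hz).hom s) =
      ((inverseImage A F).presheaf.germ (trace A U) z hz).hom (unitSec A F U s) := by
  have h1 := stalkMap_germ ((TopCat.Sheaf.pullbackPushforwardAdjunction (ModuleCat.{0} ℂ)
    (incl A)).unit.app F) hz s
  have h2 := LinearMap.congr_fun (congrArg ModuleCat.Hom.hom (Presheaf.stalkPushforward_germ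
    (ModuleCat.{0} ℂ) (incl A) (inverseImage A F).presheaf U z hz)) (unitSec A F U s)
  exact Eq.trans (congrArg (Presheaf.stalkPushforward (ModuleCat.{0} ℂ) (incl A)
    (inverseImage A F).presheaf z).hom h1) h2

/-- The unit is surjective on germs: the morphism from `j⁻¹F` to the sheaf of families of germs
modulo germs of sections of `F` vanishes after composition with the unit. -/
theorem stalkUnit_surjective (z : TopCat.of A) : Function.Surjective (stalkUnit A F z).hom := by
  let G := (TopCat.Sheaf.pullback (ModuleCat.{0} ℂ) (incl A)).obj F
  let N : ∀ z : TopCat.of A, Submodule ℂ (G.presheaf.stalk z) :=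
    fun z => LinearMap.range (stalkUnit A F z).hom
  let D := piSheaf (X := TopCat.of A) fun z => ModuleCat.of ℂ (G.presheaf.stalk z ⧸ N z)
  let α : G ⟶ D := toPiSheaf fun z => ModuleCat.ofHom (N z).mkQ
  let adj := TopCat.Sheaf.pullbackPushforwardAdjunction (ModuleCat.{0} ℂ) (incl A)
  have hα : α = 0 := by
    refine (adj.homEquiv F D).injective ?_
    rw [Adjunction.homEquiv_unit, Adjunction.homEquiv_unit]
    refine hom_ext_app fun U s =>
      (piSheafEquiv (X := TopCat.of A) (fun z => ModuleCat.of ℂ (G.presheaf.stalk z ⧸ N z))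
        (trace A U)).injective (funext fun z => ?_)
    refine (Submodule.Quotient.mk_eq_zero (N z.1)).2 ?_
    exact ⟨_, stalkUnit_germ z.1 z.2 s⟩
  intro g
  obtain ⟨U, hz, s, rfl⟩ := exists_germ_eq (F := G) g
  have h := congrArg (fun φ => piSheafEquiv _ U (app φ U s) ⟨z, hz⟩) hα
  exact (Submodule.Quotient.mk_eq_zero (N z)).1 h

/-- Sections of `j⁻¹F` come locally from sections of `F`. -/
theorem exists_unitSec_eq {W : Opens (TopCat.of A)} (σ : (inverseImage A F).presheaf.obj (op W))
    (z : A) (hz : z ∈ W) : ∃ (U : Opens (TopCat.of X)) (hU : trace A U ≤ W)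
      (t : F.presheaf.obj (op U)), z.1 ∈ U ∧ unitSec A F U t = res (inverseImage A F) hU σ := by
  obtain ⟨g, hg⟩ := stalkUnit_surjective z (((inverseImage A F).presheaf.germ W z hz).hom σ)
  obtain ⟨U, hzU, t, rfl⟩ := exists_germ_eq (F := F) g
  rw [stalkUnit_germ] at hg
  obtain ⟨W', hW'U, hW'W, hzW', h⟩ := exists_res_eq_of_germ_eq (F := inverseImage A F) _ _ hg
  obtain ⟨O, hO, hOW⟩ := isOpen_induced_iff.1 W'.isOpen
  have hle : trace A (U ⊓ ⟨O, hO⟩) ≤ W' := by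
    intro y hy
    have : y ∈ (Subtype.val ⁻¹' O : Set A) := hy.2
    rw [hOW] at this
    exact this
  refine ⟨U ⊓ ⟨O, hO⟩, hle.trans hW'W, res F inf_le_left t, ⟨hzU, ?_⟩, ?_⟩
  · have : z ∈ (Subtype.val ⁻¹' O : Set A) := by rw [hOW]; exact hzW'
    exact this
  · rw [unitSec_res, ← res_res hle hW'W, ← h, res_res]

/-- Two sections of `F` with the same image in `j⁻¹F` agree near `A`. -/
theorem exists_res_eq_of_unitSec_eq {U : Opens (TopCat.of X)} {s t : F.presheaf.obj (op U)}
    (h : unitSec A F U s = unitSec A F U t) :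
    ∃ (W : Opens (TopCat.of X)) (hW : W ≤ U), res F hW s = res F hW t ∧ A ∩ U ⊆ W := by
  obtain ⟨W, hW, hst, hmax⟩ := exists_maximal_eq s t
  refine ⟨W, hW, hst, fun z hz => ?_⟩
  have h0 := germ_eq_zero_of_unitSec_eq_zero (s := s - t) (by rw [map_sub, h, sub_self])
    ⟨z, hz.1⟩ hz.2
  rw [map_sub, sub_eq_zero] at h0
  obtain ⟨W', h1, h2, hzW', h3⟩ := exists_res_eq_of_germ_eq _ _ h0
  exact hmax W' h1 h3 hzW'

theorem exists_res_eq_of_toSectionsOn_eq {U : Opens (TopCat.of X)} (hU : A ⊆ U)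
    {s t : F.presheaf.obj (op U)}
    (h : (toSectionsOn A F U hU).hom s = (toSectionsOn A F U hU).hom t) :
    ∃ (W : Opens (TopCat.of X)) (hW : W ≤ U), A ⊆ W ∧ res F hW s = res F hW t := by
  rw [toSectionsOn_apply, toSectionsOn_apply] at h
  have h' := congrArg (res (inverseImage A F) (le_top : trace A U ≤ ⊤)) h
  rw [res_res, res_res, res_self, res_self] at h'
  obtain ⟨W, hW, hst, hAW⟩ := exists_res_eq_of_unitSec_eq h'
  exact ⟨W, hW, fun z hz => hAW ⟨hz, hU hz⟩, hst⟩

/-- Sections of `j⁻¹F` near two compact subsets of `A` which come from `F` glue to a section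
which comes from `F`: the domains are shrunk until the two sections agree on the overlap. -/
theorem exists_unitSec_eq_union [T2Space X] (σ : (inverseImage A F).presheaf.obj (op ⊤))
    {K₁ K₂ : Set A} (hK₁ : IsCompact K₁) (hK₂ : IsCompact K₂) {U₁ U₂ : Opens (TopCat.of X)}
    (h₁ : ∀ z ∈ K₁, z.1 ∈ U₁) (h₂ : ∀ z ∈ K₂, z.1 ∈ U₂)
    {t₁ : F.presheaf.obj (op U₁)} {t₂ : F.presheaf.obj (op U₂)}
    (ht₁ : unitSec A F U₁ t₁ = res (inverseImage A F) le_top σ)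
    (ht₂ : unitSec A F U₂ t₂ = res (inverseImage A F) le_top σ) :
    ∃ (U : Opens (TopCat.of X)) (t : F.presheaf.obj (op U)), (∀ z ∈ K₁ ∪ K₂, z.1 ∈ U) ∧
      unitSec A F U t = res (inverseImage A F) le_top σ := by
  obtain ⟨W, hW, hWt, hAW⟩ := exists_res_eq_of_unitSec_eq (A := A)
    (s := res F (inf_le_left : U₁ ⊓ U₂ ≤ U₁) t₁) (t := res F inf_le_right t₂) (by
      rw [unitSec_res, unitSec_res, ht₁, ht₂, res_res, res_res])
  obtain ⟨O₁, O₂, hO₁, hO₂, hKO₁, hKO₂, hdisj⟩ : SeparatedNhds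
      (Subtype.val '' K₁ \ (W : Set X)) (Subtype.val '' K₂ \ (W : Set X)) := by
    refine SeparatedNhds.of_isCompact_isCompact
      ((hK₁.image continuous_subtype_val).diff W.isOpen)
      ((hK₂.image continuous_subtype_val).diff W.isOpen) ?_
    rw [Set.disjoint_left]
    rintro x ⟨⟨z, hz, rfl⟩, hzW⟩ ⟨⟨y, hy, hyz⟩, -⟩
    exact hzW (hAW ⟨z.2, h₁ z hz, hyz ▸ h₂ y hy⟩)
  let V₁ : Opens (TopCat.of X) := (⟨O₁, hO₁⟩ ⊔ W) ⊓ U₁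
  let V₂ : Opens (TopCat.of X) := (⟨O₂, hO₂⟩ ⊔ W) ⊓ U₂
  have hV : V₁ ⊓ V₂ ≤ W := by
    rintro x ⟨⟨h | h, -⟩, ⟨h' | h', -⟩⟩
    · exact (Set.disjoint_left.1 hdisj h h').elim
    all_goals assumption
  obtain ⟨t, hl, hr⟩ := exists_glue (F := F) (le_sup_left : V₁ ≤ V₁ ⊔ V₂)
    (le_sup_right : V₂ ≤ V₁ ⊔ V₂) le_rfl (res F inf_le_right t₁) (res F inf_le_right t₂) (by
      rw [res_res] at hWt
      rw [res_res] at hWt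
      have := congrArg (res F hV) hWt
      rw [res_res, res_res] at this
      rw [res_res, res_res]
      exact this)
  refine ⟨V₁ ⊔ V₂, t, ?_, ?_⟩
  · rintro z (hz | hz)
    · refine Or.inl ⟨?_, h₁ z hz⟩
      by_cases hzW : z.1 ∈ W
      · exact Or.inr hzW
      · exact Or.inl (hKO₁ ⟨⟨z, hz, rfl⟩, hzW⟩)
    · refine Or.inr ⟨?_, h₂ z hz⟩
      by_cases hzW : z.1 ∈ W
      · exact Or.inr hzW
      · exact Or.inl (hKO₂ ⟨⟨z, hz, rfl⟩, hzW⟩)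
  · refine eq_of_locally_eq fun z hz => ?_
    rcases hz with hz | hz
    · refine ⟨trace A V₁, trace_mono A (le_sup_left : V₁ ≤ V₁ ⊔ V₂), hz, ?_⟩
      rw [← unitSec_res le_sup_left, hl, unitSec_res, ht₁, res_res, res_res]
    · refine ⟨trace A V₂, trace_mono A (le_sup_right : V₂ ≤ V₁ ⊔ V₂), hz, ?_⟩
      rw [← unitSec_res le_sup_right, hr, unitSec_res, ht₂, res_res, res_res]

/-- Sections of `j⁻¹F` over a compact subset `A` of a Hausdorff space extend to sections of `F`
over a neighbourhood of `A`. -/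
theorem exists_toSectionsOn_eq [T2Space X] (hA : IsCompact A)
    (σ : (inverseImage A F).presheaf.obj (op ⊤)) :
    ∃ (U : Opens (TopCat.of X)) (hU : A ⊆ U) (t : F.presheaf.obj (op U)),
      (toSectionsOn A F U hU).hom t = σ := by
  have : CompactSpace A := isCompact_iff_compactSpace.1 hA
  have key : ∃ K : Set A, IsCompact K ∧ Set.univ ⊆ K ∧ ∃ (U : Opens (TopCat.of X))
      (t : F.presheaf.obj (op U)), (∀ z ∈ K, z.1 ∈ U) ∧
        unitSec A F U t = res (inverseImage A F) le_top σ := by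
    refine (isCompact_univ (X := A)).induction_on
      (p := fun S => ∃ K : Set A, IsCompact K ∧ S ⊆ K ∧ ∃ (U : Opens (TopCat.of X))
        (t : F.presheaf.obj (op U)), (∀ z ∈ K, z.1 ∈ U) ∧
          unitSec A F U t = res (inverseImage A F) le_top σ) ?_ ?_ ?_ ?_
    · refine ⟨∅, isCompact_empty, subset_rfl, ⊥, 0, fun z hz => hz.elim, ?_⟩
      exact eq_of_locally_eq fun z hz => hz.elim
    · rintro S T hST ⟨K, hK, hTK, h⟩
      exact ⟨K, hK, hST.trans hTK, h⟩
    · rintro S T ⟨K₁, hK₁, hS, U₁, t₁, h₁, ht₁⟩ ⟨K₂, hK₂, hT, U₂, t₂, h₂, ht₂⟩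
      exact ⟨K₁ ∪ K₂, hK₁.union hK₂, Set.union_subset_union hS hT,
        exists_unitSec_eq_union σ hK₁ hK₂ h₁ h₂ ht₁ ht₂⟩
    · intro z _
      obtain ⟨U, hU, t, hzU, ht⟩ := exists_unitSec_eq σ z trivial
      obtain ⟨K, hK, hKU, hKc⟩ := local_compact_nhds
        ((trace A U).isOpen.mem_nhds (show z ∈ trace A U from hzU))
      exact ⟨K, mem_nhdsWithin_of_mem_nhds hK, K, hKc, subset_rfl, U, t, fun y hy => hKU hy, ht⟩
  obtain ⟨K, -, hK, U, t, hU, ht⟩ := key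
  have hAU : A ⊆ U := fun z hz => hU ⟨z, hz⟩ (hK trivial)
  refine ⟨U, hAU, t, ?_⟩
  rw [toSectionsOn_apply, ht, res_res, res_self]

theorem exists_res_eq_of_toSectionsOn_eq' {U V : Opens (TopCat.of X)} (hU : A ⊆ U) (hV : A ⊆ V)
    {s : F.presheaf.obj (op U)} {t : F.presheaf.obj (op V)}
    (h : (toSectionsOn A F U hU).hom s = (toSectionsOn A F V hV).hom t) :
    ∃ (W : Opens (TopCat.of X)) (hWU : W ≤ U) (hWV : W ≤ V), A ⊆ W ∧
      res F hWU s = res F hWV t := by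
  have hUV : A ⊆ (U ⊓ V : Opens (TopCat.of X)) := Set.subset_inter hU hV
  obtain ⟨W, hW, hAW, hst⟩ := exists_res_eq_of_toSectionsOn_eq hUV
    (s := res F inf_le_left s) (t := res F inf_le_right t) (by
      rw [toSectionsOn_res, toSectionsOn_res, h])
  rw [res_res, res_res] at hst
  exact ⟨W, hW.trans inf_le_left, hW.trans inf_le_right, hAW, hst⟩

/-- `Γ(A, j⁻¹F)` is the colimit of the `Γ(U, F)` over the neighbourhoods `U` of a compact `A`. -/
theorem nonempty_isColimit_sectionsCocone [T2Space X] (hA : IsCompact A)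
    (F : TopCat.Sheaf (ModuleCat.{0} ℂ) (TopCat.of X)) :
    Nonempty (IsColimit (sectionsCocone A F)) := by
  let inf (U V : Nhds A) : Nhds A := ⟨U.1 ⊓ V.1, Set.subset_inter U.2 V.2⟩
  have : Nonempty (Nhds A) := ⟨⟨⊤, Set.subset_univ A⟩⟩
  have hdir : IsDirectedOrder (Nhds A)ᵒᵈ :=
    ⟨fun U V => ⟨inf U V, show (inf U V).1 ≤ U.1 from inf_le_left,
      show (inf U V).1 ≤ V.1 from inf_le_right⟩⟩
  have : IsCodirectedOrder (Nhds A) := ⟨fun U V => ⟨inf U V,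
    show (inf U V).1 ≤ U.1 from inf_le_left, show (inf U V).1 ≤ V.1 from inf_le_right⟩⟩
  have : IsFiltered (Nhds A)ᵒᵖ := inferInstance
  refine ⟨isColimitOfReflects (forget (ModuleCat.{0} ℂ)) ?_⟩
  refine Types.FilteredColimit.isColimitOf _ _ ?_ ?_
  · intro σ
    obtain ⟨U, hU, t, ht⟩ := exists_toSectionsOn_eq hA σ
    exact ⟨op ⟨U, hU⟩, t, ht.symm⟩
  · intro U V s t h
    obtain ⟨W, hWU, hWV, hAW, hst⟩ := exists_res_eq_of_toSectionsOn_eq' U.unop.2 V.unop.2 h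
    exact ⟨op ⟨W, hAW⟩, (homOfLE hWU : (⟨W, hAW⟩ : Nhds A) ⟶ U.unop).op,
      (homOfLE hWV : (⟨W, hAW⟩ : Nhds A) ⟶ V.unop).op, hst⟩

end InverseImageSections

end Hartogs

end

/-! ### Injective resolutions and first derived functors -/

noncomputable section

open TopCat Limits

namespace Hartogs

section Resolutions

universe v u v' u'

/-- The first right derived functor is computed by cycles modulo boundaries of a resolution. -/
theorem exists_surjective_rightDerived_one {C : Type u} [Category.{v} C] [Abelian C]
    [HasInjectiveResolutions C] {F : C} (I : InjectiveResolution F)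
    (G : C ⥤ ModuleCat.{0} ℂ) [G.Additive] :
    ∃ p : LinearMap.ker (G.map (I.cocomplex.d 1 2)).hom →ₗ[ℂ] (G.rightDerived 1).obj F,
      Function.Surjective p ∧ ∀ x, p x = 0 ↔ ∃ t, (G.map (I.cocomplex.d 0 1)).hom t = x.1 := by
  let K := (G.mapHomologicalComplex (ComplexShape.up ℕ)).obj I.cocomplex
  let S := K.sc' 0 1 2
  let e : (G.rightDerived 1).obj F ≅ S.moduleCatLeftHomologyData.H :=
    I.isoRightDerivedObj G 1 ≪≫
      ShortComplex.homologyMapIso (K.isoSc' 0 1 2 (by simp) (by simp)) ≪≫ S.moduleCatHomologyIso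
  let N := LinearMap.range S.moduleCatToCycles
  let p : LinearMap.ker S.g.hom →ₗ[ℂ] (G.rightDerived 1).obj F :=
    e.toLinearEquiv.symm.toLinearMap ∘ₗ N.mkQ
  have hp : Function.Surjective p := e.toLinearEquiv.symm.surjective.comp N.mkQ_surjective
  refine ⟨p, hp, fun x => ?_⟩
  refine (e.toLinearEquiv.symm.map_eq_zero_iff (x := N.mkQ x)).trans ?_
  have hN : N.mkQ x = 0 ↔ x ∈ N := Submodule.Quotient.mk_eq_zero N
  refine hN.trans ?_
  constructor
  · intro hx
    obtain ⟨t, ht⟩ := hx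
    exact ⟨t, congrArg Subtype.val ht⟩
  · intro hx
    obtain ⟨t, ht⟩ := hx
    exact ⟨t, Subtype.ext ht⟩

/-- Exact functors preserving injective objects map injective resolutions to injective
resolutions. -/
def mapInjectiveResolution {C : Type u} {D : Type u'} [Category.{v} C] [Abelian C]
    [Category.{v'} D] [Abelian D]
    (R : C ⥤ D) [R.Additive] [R.PreservesInjectiveObjects] [R.PreservesHomology] {Z : C}
    (I : InjectiveResolution Z) : InjectiveResolution (R.obj Z) where
  cocomplex := (R.mapHomologicalComplex _).obj I.cocomplex
  injective n := Functor.PreservesInjectiveObjects.injective_obj (I.injective n)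
  ι := (HomologicalComplex.singleMapHomologicalComplex _ _ _).inv.app _ ≫
    (R.mapHomologicalComplex _).map I.ι
  quasiIso := inferInstance

/-- If `W` surjects onto `A` and the kernel of a map `W → B` dies in `A`, then
`dim A ≤ dim B`. -/
theorem rank_le_of_ker_le {W A B : Type} [AddCommGroup W] [AddCommGroup A] [AddCommGroup B]
    [Module ℂ W] [Module ℂ A] [Module ℂ B] (f : W →ₗ[ℂ] A) (hf : Function.Surjective f)
    (g : W →ₗ[ℂ] B) (h : LinearMap.ker g ≤ LinearMap.ker f) :
    Module.rank ℂ A ≤ Module.rank ℂ B := by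
  obtain ⟨k, hk⟩ : ∃ k : A →ₗ[ℂ] W, f ∘ₗ k = LinearMap.id :=
    f.exists_rightInverse_of_surjective (LinearMap.range_eq_top.2 hf)
  refine LinearMap.rank_le_of_injective (g ∘ₗ k) ?_
  rw [← LinearMap.ker_eq_bot, Submodule.eq_bot_iff]
  intro x hx
  have h1 : f (k x) = 0 := h (show g (k x) = 0 from hx)
  exact (LinearMap.congr_fun hk x).symm.trans h1

variable {X : TopCat.{0}} {F : TopCat.Sheaf (ModuleCat.{0} ℂ) X}

/-- The augmentation of a resolution. -/
def augmentation (I : InjectiveResolution F) : F ⟶ I.cocomplex.X 0 := I.ι.f 0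

instance (I : InjectiveResolution F) : Mono (augmentation I) :=
  inferInstanceAs (Mono (I.ι.f 0))

/-- Taking sections over `U` is left exact. -/
theorem exists_app_augmentation_eq (I : InjectiveResolution F) {U : Opens X}
    {s : (I.cocomplex.X 0).presheaf.obj (op U)} (hs : app (I.cocomplex.d 0 1) U s = 0) :
    ∃ g, app (augmentation I) U g = s := by
  let Γ : TopCat.Sheaf (ModuleCat.{0} ℂ) X ⥤ ModuleCat.{0} ℂ :=
    sheafToPresheaf _ _ ⋙ (evaluation _ _).obj (op U)
  have h₂ : PreservesFiniteLimits ((evaluation (Opens X)ᵒᵖ (ModuleCat.{0} ℂ)).obj (op U)) :=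
    inferInstance
  have h₁ : PreservesFiniteLimits (sheafToPresheaf (Opens.grothendieckTopology X)
    (ModuleCat.{0} ℂ)) :=
    have := (sheafificationAdjunction (Opens.grothendieckTopology X)
      (ModuleCat.{0} ℂ)).rightAdjoint_preservesLimits
    PreservesLimits.preservesFiniteLimits _
  have : PreservesFiniteLimits Γ := @comp_preservesFiniteLimits _ _ _ _ _ _ _ _ h₁ h₂
  let S := ShortComplex.mk (augmentation I) (I.cocomplex.d 0 1) I.ι_f_zero_comp_complex_d
  have hS : S.Exact := ShortComplex.exact_of_f_is_kernel S I.isLimitKernelFork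
  have : Γ.Additive := ⟨rfl⟩
  have h := ((Γ.preservesFiniteLimits_tfae).out 1 3 rfl rfl).2 inferInstance S
    ⟨hS, inferInstanceAs (Mono (augmentation I))⟩
  exact (ShortComplex.moduleCat_exact_iff _).1 h.1 s hs

theorem app_d_augmentation (I : InjectiveResolution F) (U : Opens X)
    (g : F.presheaf.obj (op U)) : app (I.cocomplex.d 0 1) U (app (augmentation I) U g) = 0 := by
  rw [← app_comp]
  have : augmentation I ≫ I.cocomplex.d 0 1 = 0 := I.ι_f_zero_comp_complex_d
  rw [this, app_zero]

theorem app_d_d (I : InjectiveResolution F) (U : Opens X)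
    (s : (I.cocomplex.X 0).presheaf.obj (op U)) :
    app (I.cocomplex.d 1 2) U (app (I.cocomplex.d 0 1) U s) = 0 := by
  rw [← app_comp, I.cocomplex.d_comp_d, app_zero]

end Resolutions

end Hartogs

end

/-! ### Restriction to open subspaces -/

noncomputable section

open TopCat Limits

namespace Hartogs

section OpenRestriction

theorem preservesFiniteLimits_pullback {X Y : TopCat.{0}} (f : X ⟶ Y) :
    PreservesFiniteLimits (TopCat.Sheaf.pullback (ModuleCat.{0} ℂ) f) :=
  Functor.SmallCategories.instPreservesFiniteLimitsSheafSheafPullbackOfRepresentablyFlat _ _ _ _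

variable {X : Type} [TopologicalSpace X] (Y : Opens X)

/-- The inclusion of an open subspace. -/
def openIncl : TopCat.of Y ⟶ TopCat.of X := incl (Y : Set X)

theorem isOpenEmbedding_openIncl : Topology.IsOpenEmbedding (openIncl Y) :=
  Y.isOpen.isOpenEmbedding_subtypeVal

/-- Restriction of sheaves to an open subspace `Y`; the sections over `U` are the sections over
the image of `U` in `X`. -/
def restrictOpen :
    TopCat.Sheaf (ModuleCat.{0} ℂ) (TopCat.of X) ⥤ TopCat.Sheaf (ModuleCat.{0} ℂ) (TopCat.of Y) :=
  (isOpenEmbedding_openIncl Y).sheafPullback (ModuleCat.{0} ℂ)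

/-- The restriction to an open subspace is its topological inverse image. -/
def inverseImageIso (F : TopCat.Sheaf (ModuleCat.{0} ℂ) (TopCat.of X)) :
    (TopCat.Sheaf.pullback (ModuleCat.{0} ℂ) (openIncl Y)).obj F ≅ (restrictOpen Y).obj F :=
  ((isOpenEmbedding_openIncl Y).sheafPullbackIso (ModuleCat.{0} ℂ)).app F

/-- An open subset of `Y` as an open subset of `X`. -/
def imageOpen (U : Opens (TopCat.of Y)) : Opens (TopCat.of X) :=
  (isOpenEmbedding_openIncl Y).functor.obj U

theorem mem_imageOpen {U : Opens (TopCat.of Y)} {x : X} :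
    x ∈ imageOpen Y U ↔ ∃ h : x ∈ Y, (⟨x, h⟩ : Y) ∈ U := by
  constructor
  · rintro ⟨y, hy, rfl⟩
    exact ⟨y.2, hy⟩
  · rintro ⟨h, hU⟩
    exact ⟨⟨x, h⟩, hU, rfl⟩

theorem imageOpen_mono {U V : Opens (TopCat.of Y)} (h : U ≤ V) : imageOpen Y U ≤ imageOpen Y V :=
  Set.image_mono h

instance : (restrictOpen Y).Additive := ⟨rfl⟩

instance : (restrictOpen Y).IsLeftAdjoint :=
  Functor.isLeftAdjoint_of_iso ((isOpenEmbedding_openIncl Y).sheafPullbackIso (ModuleCat.{0} ℂ))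

instance : PreservesFiniteLimits (restrictOpen Y) := by
  have := preservesFiniteLimits_pullback (openIncl Y)
  exact preservesFiniteLimits_of_natIso
    ((isOpenEmbedding_openIncl Y).sheafPullbackIso (ModuleCat.{0} ℂ))

instance : PreservesFiniteColimits (restrictOpen Y) :=
  have := (Adjunction.ofIsLeftAdjoint (restrictOpen Y)).leftAdjoint_preservesColimits
  PreservesColimits.preservesFiniteColimits _

instance : (restrictOpen Y).PreservesHomology := inferInstance

/-- The restriction to `Y` of a sheaf of discontinuous families on `X` is identified with the sheaf
of such families on `Y`; only the retraction is recorded. -/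
def retractRestrictPiSheaf (V : X → ModuleCat.{0} ℂ) :
    Retract ((restrictOpen Y).obj (piSheaf (X := TopCat.of X) V))
      (piSheaf (X := TopCat.of Y) fun y => V y.1) where
  i := ⟨{ app := fun U => ModuleCat.ofHom ((LinearMap.pi fun y : (unop U : Opens Y) =>
            (LinearMap.proj (⟨y.1.1, (mem_imageOpen Y).2 ⟨y.1.2, y.2⟩⟩ : imageOpen Y (unop U)) :
              (∀ x : imageOpen Y (unop U), V x) →ₗ[ℂ] V y.1.1)) :
              (∀ x : imageOpen Y (unop U), V x) →ₗ[ℂ] ∀ y : (unop U : Opens Y), V y.1.1)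
          naturality := fun _ _ _ => rfl }⟩
  r := ⟨{ app := fun U => ModuleCat.ofHom ((LinearMap.pi fun x : imageOpen Y (unop U) =>
            (LinearMap.proj (⟨⟨x.1, ((mem_imageOpen Y).1 x.2).1⟩, ((mem_imageOpen Y).1 x.2).2⟩ :
              (unop U : Opens Y)) :
              (∀ y : (unop U : Opens Y), V y.1.1) →ₗ[ℂ] V x.1)) :
              (∀ y : (unop U : Opens Y), V y.1.1) →ₗ[ℂ] (∀ x : imageOpen Y (unop U), V x))
          naturality := fun _ _ _ => rfl }⟩
  retract := rfl

instance : (restrictOpen Y).PreservesInjectiveObjects where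
  injective_obj {I} _ := by
    have := ((retractPiSheaf I).map (restrictOpen Y)).trans (retractRestrictPiSheaf Y _)
    exact this.injective

end OpenRestriction

end Hartogs

end

/-! ### Comparison of cohomology groups -/

noncomputable section

open TopCat Limits

namespace Hartogs

section CohomologyComparison

variable {M : TopCat.{0}} {G : TopCat.Sheaf (ModuleCat.{0} ℂ) M}

/-- `H¹(M, G)` is the space of closed sections of `I¹` modulo exact ones. -/
theorem exists_surjective_cohomology_one (I : InjectiveResolution G) :
    ∃ p : LinearMap.ker (app (I.cocomplex.d 1 2) ⊤) →ₗ[ℂ] cohomology M 1 G,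
      Function.Surjective p ∧ ∀ x, p x = 0 ↔ ∃ t, app (I.cocomplex.d 0 1) ⊤ t = x.1 :=
  exists_surjective_rightDerived_one I (globalSections M)

/-- `H¹_c(M, G)` is the space of closed sections of `I¹` with compact support modulo differentials
of sections of `I⁰` with compact support. -/
theorem exists_surjective_compactCohomology_one (I : InjectiveResolution G) :
    ∃ p : (compactSections (I.cocomplex.X 1) ⊓ LinearMap.ker (app (I.cocomplex.d 1 2) ⊤) :
        Submodule ℂ _) →ₗ[ℂ] compactCohomology M 1 G,
      Function.Surjective p ∧ ∀ x, p x = 0 ↔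
        ∃ t ∈ compactSections (I.cocomplex.X 0), app (I.cocomplex.d 0 1) ⊤ t = x.1 := by
  obtain ⟨p, hp, hp'⟩ := exists_surjective_rightDerived_one I (compactGlobalSections M)
  let e : (compactSections (I.cocomplex.X 1) ⊓ LinearMap.ker (app (I.cocomplex.d 1 2) ⊤) :
      Submodule ℂ _) →ₗ[ℂ]
      LinearMap.ker ((compactGlobalSections M).map (I.cocomplex.d 1 2)).hom :=
    { toFun := fun x => ⟨⟨x.1, x.2.1⟩, Subtype.ext x.2.2⟩
      map_add' := fun _ _ => rfl
      map_smul' := fun _ _ => rfl }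
  have he : Function.Surjective e := by
    rintro ⟨⟨x, hx⟩, hx'⟩
    exact ⟨⟨x, hx, congrArg Subtype.val hx'⟩, rfl⟩
  refine ⟨p ∘ₗ e, hp.comp he, fun x => (hp' (e x)).trans ?_⟩
  constructor
  · rintro ⟨⟨t, ht⟩, h⟩
    exact ⟨t, ht, congrArg Subtype.val h⟩
  · rintro ⟨t, ht, h⟩
    exact ⟨⟨t, ht⟩, Subtype.ext h⟩

theorem mem_compactSections_of_res_eq_zero {K : Set M} (hK : IsCompact K) {U : Opens M}
    (hU : Kᶜ ⊆ U) {s : G.presheaf.obj (op ⊤)} (h : res G le_top s = (0 : G.presheaf.obj (op U))) :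
    s ∈ compactSections G := by
  refine IsCompact.of_isClosed_subset hK (isClosed_sectionSupport G s) fun y hy => ?_
  by_contra hyK
  exact hy U (hU hyK) h

theorem exists_res_eq_zero_of_mem_compactSections {s : G.presheaf.obj (op ⊤)}
    (h : s ∈ compactSections G) : ∃ (K : Set M) (U : Opens M), IsCompact K ∧ (U : Set M) = Kᶜ ∧
      res G (le_top : U ≤ ⊤) s = 0 := by
  refine ⟨sectionSupport G s, ⟨(sectionSupport G s)ᶜ, (isClosed_sectionSupport G s).isOpen_compl⟩,
    h, rfl, ?_⟩
  refine eq_of_locally_eq fun x hx => ?_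
  have hx' : ¬ ∀ U : Opens M, x ∈ U → G.presheaf.map (homOfLE (le_top : U ≤ ⊤)).op s ≠ 0 := hx
  push Not at hx'
  obtain ⟨W, hxW, hW⟩ := hx'
  refine ⟨_ ⊓ W, inf_le_left, ⟨hx, hxW⟩, ?_⟩
  rw [res_res, map_zero, ← res_res inf_le_right (le_top : W ≤ ⊤)]
  exact (congrArg _ hW).trans (map_zero _)

variable (G) in
/-- A resolution `0 → G → I₀ → I₁ → I₂` computing `H¹_c(M, G)`, on sections. -/
theorem exists_resolution_compactCohomology :
    ∃ (I₀ I₁ I₂ : TopCat.Sheaf (ModuleCat.{0} ℂ) M) (ι : G ⟶ I₀) (d₀ : I₀ ⟶ I₁) (d₁ : I₁ ⟶ I₂)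
      (p : (compactSections I₁ ⊓ LinearMap.ker (app d₁ ⊤) : Submodule ℂ _) →ₗ[ℂ]
        compactCohomology M 1 G),
      (∀ (U : Opens M) (s : I₀.presheaf.obj (op U)), ∃ t, res I₀ (le_top : U ≤ ⊤) t = s) ∧
      (∀ U, Function.Injective (app ι U)) ∧
      (∀ U s, app d₀ U s = 0 ↔ ∃ g, app ι U g = s) ∧ (∀ U s, app d₁ U (app d₀ U s) = 0) ∧
      ∀ x, p x = 0 ↔ ∃ t ∈ compactSections I₀, app d₀ ⊤ t = x.1 := by
  let I := injectiveResolution G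
  obtain ⟨p, -, hp⟩ := exists_surjective_compactCohomology_one I
  refine ⟨_, _, _, augmentation I, I.cocomplex.d 0 1, I.cocomplex.d 1 2, p,
    fun U => exists_res_eq_of_injective _ le_top, app_injective_of_mono _,
    fun U s => ⟨exists_app_augmentation_eq I, ?_⟩, app_d_d I, hp⟩
  rintro ⟨g, rfl⟩
  exact app_d_augmentation I U g

/-- If sections of `G` over `U = M ∖ K` vanishing outside a compact set vanish, then the space of
sections over `U` modulo the global ones embeds into `H¹_c(M, G)`: extend a section over `U` to a
section `s` of `I⁰` over `M`; the differential of `s` is supported in `K`. -/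
theorem rank_quotient_range_res_le {K : Set M} (hK : IsCompact K) {U : Opens M}
    (hU : (U : Set M) = Kᶜ)
    (h : ∀ (L : Set M) (V : Opens M), IsCompact L → (V : Set M) = Lᶜ →
      ∀ g : G.presheaf.obj (op U), res G (inf_le_left : U ⊓ V ≤ U) g = 0 → g = 0) :
    Module.rank ℂ (G.presheaf.obj (op U) ⧸ LinearMap.range (res G (le_top : U ≤ ⊤))) ≤
      Module.rank ℂ (compactCohomology M 1 G) := by
  obtain ⟨I₀, I₁, I₂, ι, d₀, d₁, p, hflasque, hι, hd₀, hdd, hp⟩ :=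
    exists_resolution_compactCohomology G
  let N := LinearMap.range (res G (le_top : U ≤ ⊤))
  let S : Submodule ℂ ((I₀).presheaf.obj (op ⊤) × G.presheaf.obj (op U)) :=
    LinearMap.eqLocus (res _ (le_top : U ≤ ⊤) ∘ₗ LinearMap.fst ℂ _ _)
      (app ι U ∘ₗ LinearMap.snd ℂ _ _)
  let d : S →ₗ[ℂ] (compactSections (I₁) ⊓
      LinearMap.ker (app (d₁) ⊤) : Submodule ℂ _) :=
    LinearMap.codRestrict _ (app (d₀) ⊤ ∘ₗ LinearMap.fst ℂ _ _ ∘ₗ S.subtype) (by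
      rintro ⟨⟨s, f⟩, hsf⟩
      have hsf' : res _ (le_top : U ≤ ⊤) s = app ι U f := hsf
      refine ⟨mem_compactSections_of_res_eq_zero hK hU.ge ?_, hdd ⊤ s⟩
      change res _ (le_top : U ≤ ⊤) (app (d₀) ⊤ s) = 0
      rw [← app_res, hsf', hd₀]
      exact ⟨f, rfl⟩)
  refine rank_le_of_ker_le (N.mkQ ∘ₗ LinearMap.snd ℂ _ _ ∘ₗ S.subtype) ?_ (p ∘ₗ d) ?_
  · intro q
    obtain ⟨f, rfl⟩ := N.mkQ_surjective q
    obtain ⟨s, hs⟩ := hflasque U (app ι U f)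
    exact ⟨⟨⟨s, f⟩, hs⟩, rfl⟩
  · rintro ⟨⟨s, f⟩, hsf⟩ hker
    have hsf' : res _ (le_top : U ≤ ⊤) s = app ι U f := hsf
    obtain ⟨t, ht, hts⟩ := (hp _).1 hker
    have hts' : app (d₀) ⊤ t = app (d₀) ⊤ s := hts
    obtain ⟨g, hg⟩ := (hd₀ ⊤ (s - t)).1 (by
      rw [map_sub, hts', sub_self])
    obtain ⟨L, V, hL, hV, htV⟩ := exists_res_eq_zero_of_mem_compactSections ht
    refine (Submodule.Quotient.mk_eq_zero N).2 ⟨g, ?_⟩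
    refine (sub_eq_zero.1 (h L V hL hV (f - res G (le_top : U ≤ ⊤) g) ?_)).symm
    refine hι (U ⊓ V) ?_
    have h₁ : res (I₀) (inf_le_left : U ⊓ V ≤ U) (res _ (le_top : U ≤ ⊤) t) = 0 := by
      rw [res_res, ← res_res inf_le_right (le_top : V ≤ ⊤), htV, map_zero]
    have h₂ : app ι U (f - res G (le_top : U ≤ ⊤) g) = res _ (le_top : U ≤ ⊤) t := by
      have e : app ι U (res G le_top g) =
          res _ (le_top : U ≤ ⊤) s - res _ (le_top : U ≤ ⊤) t := by
        rw [app_res, hg]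
        exact (res _ _).map_sub s t
      refine ((app ι U).map_sub f (res G (le_top : U ≤ ⊤) g)).trans ?_
      rw [e, ← hsf']
      exact sub_sub_cancel _ _
    rw [app_res, h₂, h₁, LinearMap.map_zero]

end CohomologyComparison

/-- If `P` surjects onto `A` and a linear correspondence between `P` and `Q`, defined on all of
`P`, sends to zero in `A` whatever corresponds to zero in `B`, then `dim A ≤ dim B`. -/
theorem rank_le_of_correspondence {A B P Q : Type} [AddCommGroup A] [AddCommGroup B]
    [AddCommGroup P] [AddCommGroup Q] [Module ℂ A] [Module ℂ B] [Module ℂ P] [Module ℂ Q]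
    (p : P →ₗ[ℂ] A) (hp : Function.Surjective p) (q : Q →ₗ[ℂ] B) (W : Submodule ℂ (P × Q))
    (hW : ∀ c, ∃ s, (c, s) ∈ W) (hpq : ∀ c s, (c, s) ∈ W → q s = 0 → p c = 0) :
    Module.rank ℂ A ≤ Module.rank ℂ B := by
  refine rank_le_of_ker_le (p ∘ₗ LinearMap.fst ℂ _ _ ∘ₗ W.subtype) ?_
    (q ∘ₗ LinearMap.snd ℂ _ _ ∘ₗ W.subtype) ?_
  · intro a
    obtain ⟨c, rfl⟩ := hp a
    obtain ⟨s, hs⟩ := hW c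
    exact ⟨⟨(c, s), hs⟩, rfl⟩
  · rintro ⟨⟨c, s⟩, hs⟩ hker
    exact hpq c s hs hker

section CompactSpace

variable {X : Type} [TopologicalSpace X] {Y : Opens X}
  {F : TopCat.Sheaf (ModuleCat.{0} ℂ) (TopCat.of X)}

/-- A section over `Y` has compact support if and only if it vanishes near `Z = X ∖ Y`. -/
theorem mem_compactSections_restrictOpen_iff [T2Space X] [CompactSpace X] {Z : Set X}
    (hY : (Y : Set X) = Zᶜ) {s : F.presheaf.obj (op (imageOpen Y ⊤))} :
    (show ((restrictOpen Y).obj F).presheaf.obj (op ⊤) from s) ∈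
      compactSections ((restrictOpen Y).obj F) ↔
    ∃ V : Opens (TopCat.of X), Z ⊆ V ∧
      res F (inf_le_left : imageOpen Y ⊤ ⊓ V ≤ imageOpen Y ⊤) s = 0 := by
  constructor
  · intro hs
    obtain ⟨K, U, hK, hU, hcU⟩ := exists_res_eq_zero_of_mem_compactSections hs
    let V : Opens (TopCat.of X) :=
      ⟨(Subtype.val '' K)ᶜ, (hK.image continuous_subtype_val).isClosed.isOpen_compl⟩
    have hTV : imageOpen Y ⊤ ⊓ V ≤ imageOpen Y U := by
      rintro x ⟨hx, hxV⟩
      obtain ⟨hxY, -⟩ := (mem_imageOpen Y).1 hx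
      refine (mem_imageOpen Y).2 ⟨hxY, ?_⟩
      have : (⟨x, hxY⟩ : Y) ∈ Kᶜ := fun hxK => hxV ⟨_, hxK, rfl⟩
      exact hU.ge this
    refine ⟨V, ?_, ?_⟩
    · rintro z hz ⟨y, -, rfl⟩
      have : y.1 ∈ Zᶜ := hY ▸ y.2
      exact this hz
    · have := congrArg (res F hTV) hcU
      refine Eq.trans ?_ (this.trans (map_zero _))
      exact (res_res (F := F) hTV (imageOpen_mono Y le_top) _).symm
  · rintro ⟨V, hZV, hV⟩
    let K : Set Y := Subtype.val ⁻¹' (V : Set X)ᶜ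
    have hK : IsCompact K := by
      have : (V : Set X)ᶜ ⊆ Set.range (Subtype.val : Y → X) := by
        intro x hx
        have hxY : x ∈ (Y : Set X) := hY ▸ fun hxZ => hx (hZV hxZ)
        exact ⟨⟨x, hxY⟩, rfl⟩
      exact Topology.IsInducing.subtypeVal.isCompact_preimage' V.isOpen.isClosed_compl.isCompact
        this
    let U : Opens (TopCat.of Y) := ⟨Subtype.val ⁻¹' (V : Set X), V.isOpen.preimage
      continuous_subtype_val⟩
    refine mem_compactSections_of_res_eq_zero (U := U) hK (fun y hy => not_not.1 hy) ?_
    have hle : imageOpen Y U ≤ imageOpen Y ⊤ ⊓ V := by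
      intro x hx
      obtain ⟨hxY, hxV⟩ := (mem_imageOpen Y).1 hx
      exact ⟨(mem_imageOpen Y).2 ⟨hxY, trivial⟩, hxV⟩
    refine Eq.trans (res_res (F := F) hle inf_le_left s).symm ?_
    exact (congrArg _ hV).trans (map_zero _)

/-- A resolution `0 → F → I₀ → I₁ → I₂` computing both `H¹(X, F)` and `H¹_c(Y, F)`, on
sections. The sections over `Y` with compact support are those vanishing near `Z = X ∖ Y`. -/
theorem exists_resolution_restrictOpen [T2Space X] [CompactSpace X] {Z : Set X}
    (hY : (Y : Set X) = Zᶜ) (F : TopCat.Sheaf (ModuleCat.{0} ℂ) (TopCat.of X))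
    (T : Opens (TopCat.of X)) (hT : T = imageOpen Y ⊤) :
    ∃ (I₀ I₁ I₂ : TopCat.Sheaf (ModuleCat.{0} ℂ) (TopCat.of X)) (ι : F ⟶ I₀) (d₀ : I₀ ⟶ I₁)
      (d₁ : I₁ ⟶ I₂) (C : Submodule ℂ (I₁.presheaf.obj (op T)))
      (p : C →ₗ[ℂ] compactCohomology (TopCat.of Y) 1 ((restrictOpen Y).obj F))
      (q : LinearMap.ker (app d₁ ⊤) →ₗ[ℂ] cohomology (TopCat.of X) 1 F),
      (∀ U s, app d₀ U s = 0 ↔ ∃ g, app ι U g = s) ∧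
      (∀ c, c ∈ C ↔ app d₁ T c = 0 ∧ ∃ V : Opens (TopCat.of X), Z ⊆ V ∧
        res I₁ (inf_le_left : T ⊓ V ≤ T) c = 0) ∧
      Function.Surjective p ∧
      (∀ c, p c = 0 ↔ ∃ t : I₀.presheaf.obj (op T), (∃ V : Opens (TopCat.of X), Z ⊆ V ∧
        res I₀ (inf_le_left : T ⊓ V ≤ T) t = 0) ∧ app d₀ T t = c.1) ∧
      ∀ x, q x = 0 ↔ ∃ t, app d₀ ⊤ t = x.1 := by
  subst hT
  let I := injectiveResolution F
  obtain ⟨p, hps, hp⟩ :=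
    exists_surjective_compactCohomology_one (mapInjectiveResolution (restrictOpen Y) I)
  obtain ⟨q, -, hq⟩ := exists_surjective_cohomology_one I
  refine ⟨_, _, _, augmentation I, I.cocomplex.d 0 1, I.cocomplex.d 1 2, _, p, q,
    fun U s => ⟨exists_app_augmentation_eq I, ?_⟩, fun c => ?_, hps, fun c => ?_, hq⟩
  · rintro ⟨g, rfl⟩
    exact app_d_augmentation I U g
  · exact and_comm.trans (and_congr_right' (mem_compactSections_restrictOpen_iff hY))
  · refine (hp c).trans (exists_congr fun t => ?_)
    exact and_congr_left' (mem_compactSections_restrictOpen_iff hY)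

/-- If `Γ(X, F) → Γ(Z, j⁻¹F)` is surjective, with `Z` the complement of `Y`, then `H¹_c(Y, F)`
embeds into `H¹(X, F)`: extended by zero, a class with compact support which dies in `H¹(X, F)`
is the differential of a section which is near `Z` a section of `F`, and can be corrected by a
global section of `F` so as to vanish near `Z`. -/
theorem rank_compactCohomology_le [T2Space X] [CompactSpace X] {Z : Set X}
    (hY : (Y : Set X) = Zᶜ) (h : Function.Surjective (restrictToSubset Z F)) :
    Module.rank ℂ (compactCohomology (TopCat.of Y) 1 ((restrictOpen Y).obj F)) ≤
      Module.rank ℂ (cohomology (TopCat.of X) 1 F) := by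
  obtain ⟨T, hTeq⟩ : ∃ T, T = imageOpen Y ⊤ := ⟨_, rfl⟩
  have hT : ∀ x, x ∈ T ↔ x ∉ Z := fun x => by
    rw [hTeq, mem_imageOpen]
    have : x ∈ (Y : Set X) ↔ x ∉ Z := by rw [hY]; exact Iff.rfl
    exact ⟨fun h => this.1 h.1, fun h => ⟨this.2 h, trivial⟩⟩
  obtain ⟨I₀, I₁, I₂, ι, d₀, d₁, C, p, q, hd₀, hC, hps, hp, hq⟩ :=
    exists_resolution_restrictOpen hY F T hTeq
  -- pairs consisting of a section over `Y` and a global extension of it which vanishes near `Z`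
  let W : Submodule ℂ (C × LinearMap.ker (app d₁ ⊤)) :=
    { carrier := {c | res I₁ (le_top : T ≤ ⊤) c.2.1 = c.1.1 ∧
        ∃ V : Opens (TopCat.of X), Z ⊆ V ∧ res I₁ (le_top : V ≤ ⊤) c.2.1 = 0}
      add_mem' := by
        rintro a b ⟨ha, V, hV, haV⟩ ⟨hb, V', hV', hbV'⟩
        refine ⟨(map_add _ _ _).trans (congrArg₂ _ ha hb), V ⊓ V', Set.subset_inter hV hV', ?_⟩
        refine (map_add _ _ _).trans ?_
        rw [← res_res inf_le_left (le_top : V ≤ ⊤), haV,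
          ← res_res inf_le_right (le_top : V' ≤ ⊤), hbV', map_zero, map_zero, add_zero]
      zero_mem' := ⟨map_zero _, ⊤, Set.subset_univ _, map_zero _⟩
      smul_mem' := by
        rintro r a ⟨ha, V, hV, haV⟩
        refine ⟨(map_smul _ _ _).trans (congrArg _ ha), V, hV, ?_⟩
        exact (map_smul _ _ _).trans ((congrArg _ haV).trans (smul_zero _)) }
  refine rank_le_of_correspondence p hps q W ?_ ?_
  · rintro ⟨c, hc⟩
    obtain ⟨hdc, V, hZV, hcV⟩ := (hC c).1 hc
    have hcov : (⊤ : Opens (TopCat.of X)) ≤ T ⊔ V := by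
      intro x _
      by_cases hx : x ∈ Z
      · exact Or.inr (hZV hx)
      · exact Or.inl ((hT x).2 hx)
    obtain ⟨s, hsT, hsV⟩ := exists_glue (F := I₁) (le_top : T ≤ ⊤)
      (le_top : V ≤ ⊤) hcov c 0 (by rw [hcV, map_zero])
    refine ⟨⟨s, ?_⟩, hsT, V, hZV, hsV⟩
    refine eq_of_locally_eq fun x hx => ?_
    rcases hcov hx with hx | hx
    · refine ⟨T, le_top, hx, ?_⟩
      rw [← app_res, hsT, map_zero, hdc]
    · refine ⟨V, le_top, hx, ?_⟩
      rw [← app_res, hsV, map_zero, map_zero]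
  · rintro c ⟨s, hs⟩ ⟨hcs, V, hZV, hsV⟩ hker
    obtain ⟨t, ht⟩ := (hq _).1 hker
    have ht' : app d₀ ⊤ t = s := ht
    have hsV' : res I₁ (le_top : V ≤ ⊤) s = 0 := hsV
    have hcs' : res I₁ (le_top : T ≤ ⊤) s = c.1 := hcs
    obtain ⟨τV, hτV⟩ := (hd₀ V (res I₀ (le_top : V ≤ ⊤) t)).1 (by rw [app_res, ht', hsV'])
    obtain ⟨τ, hτ⟩ := h ((toSectionsOn Z F V hZV).hom τV)
    obtain ⟨O, hO, hOV, hZO, hτO⟩ := exists_res_eq_of_toSectionsOn_eq' (Set.subset_univ Z) hZV hτ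
    refine (hp c).2 ⟨res I₀ (le_top : T ≤ ⊤) (t - app ι ⊤ τ), ⟨O, hZO, ?_⟩, ?_⟩
    · have htO : res I₀ (le_top : O ≤ ⊤) (t - app ι ⊤ τ) = 0 := by
        rw [map_sub, ← app_res, hτO, app_res, hτV, res_res, sub_self]
      rw [res_res, ← res_res inf_le_right (le_top : O ≤ ⊤), htO, map_zero]
    · rw [app_res, map_sub, (hd₀ ⊤ _).2 ⟨τ, rfl⟩, sub_zero, ht', hcs']

end CompactSpace

end Hartogs

end

/-! ### Analytic sets of positive codimension and finiteness criterion for the Hartogs phenomenon -/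

noncomputable section

open Topology

namespace Hartogs

section Codimension

variable {n : ℕ} {X : Type} [TopologicalSpace X] [ChartedSpace (EuclideanSpace ℂ (Fin n)) X]
  {Z : Set X}

/-- An interior point of `Z` would be a regular point of codimension zero. -/
theorem HasCodim.notMem_nhds {k : ℕ} (h : HasCodim n Z k) (hk : k ≠ 0) (x : X) : Z ∉ 𝓝 x := by
  intro hx
  obtain ⟨U, hUZ, hU, hxU⟩ := mem_nhds_iff.1 hx
  refine hk (Nat.le_zero.1 (h.2 ⟨x, hUZ hxU, U, hU, hxU, Fin.elim0, fun i => i.elim0, ?_,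
    linearIndependent_empty_type⟩))
  ext y
  exact ⟨fun hy => ⟨hy.2, fun i => i.elim0⟩, fun hy => ⟨hUZ hy.1, hy.1⟩⟩

/-- An analytic subset of positive codimension is locally contained in the zero set of a
holomorphic function which does not vanish identically. -/
theorem IsAnalyticSet.isThin (hZ : IsAnalyticSet n Z) {k : ℕ} (h : HasCodim n Z k) (hk : k ≠ 0) :
    IsThin (EuclideanSpace ℂ (Fin n)) Z := by
  intro x
  obtain ⟨U, hU, hxU, r, g, hg, hZU⟩ := hZ x
  have hex : ∃ i, ∃ᶠ y in 𝓝 x, g i y ≠ 0 := by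
    by_contra hcon
    push Not at hcon
    refine h.notMem_nhds hk x ?_
    have hall : ∀ᶠ y in 𝓝 x, ∀ i, g i y = 0 :=
      Filter.eventually_all.2 fun i => by simpa using hcon i
    filter_upwards [hall, hU.mem_nhds hxU] with y hy hyU
    have : y ∈ Z ∩ U := hZU ▸ ⟨hyU, hy⟩
    exact this.1
  obtain ⟨i, hi⟩ := hex
  refine ⟨g i, (hg i).contMDiffAt (hU.mem_nhds hxU), hi, ?_⟩
  filter_upwards [hU.mem_nhds hxU] with y hyU hyZ
  have : y ∈ Z ∩ U := ⟨hyZ, hyU⟩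
  rw [hZU] at this
  exact this.2 i

end Codimension

section HartogsOfFinite

variable {n : ℕ} {M : Type} [TopologicalSpace M] [ChartedSpace (EuclideanSpace ℂ (Fin n)) M]

theorem res_structureSheaf_apply {U V : Opens M} (h : U ≤ V)
    (f : C^ω⟮𝓘(ℂ, EuclideanSpace ℂ (Fin n)), V; 𝓘(ℂ, ℂ), ℂ⟯) (y : U) :
    (show C^ω⟮𝓘(ℂ, EuclideanSpace ℂ (Fin n)), U; 𝓘(ℂ, ℂ), ℂ⟯ from
      res (X := TopCat.of M) (structureSheaf n M) h f) y = f ⟨y.1, h y.2⟩ := rfl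

/-- Identity theorem for sections of the structure sheaf. -/
theorem eq_zero_of_res_eq_zero [IsManifold 𝓘(ℂ, EuclideanSpace ℂ (Fin n)) ω M] {U V : Opens M}
    (h : V ≤ U) (hU : IsPreconnected (U : Set M)) (hV : (V : Set M).Nonempty)
    (g : (structureSheaf n M).presheaf.obj (op U))
    (hg : res (X := TopCat.of M) (structureSheaf n M) h g = 0) : g = 0 := by
  obtain ⟨x₀, hx₀⟩ := hV
  let u : C^ω⟮𝓘(ℂ, EuclideanSpace ℂ (Fin n)), U; 𝓘(ℂ, ℂ), ℂ⟯ := g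
  have hUp : PreconnectedSpace U := isPreconnected_iff_preconnectedSpace.1 hU
  have key := eqOn_zero_of_isPreconnected (E := EuclideanSpace ℂ (Fin n)) (M := U) (u := u)
    isPreconnected_univ (fun x _ => u.contMDiff x) (Set.mem_univ ⟨x₀, h hx₀⟩) (by
      have hmem : (Subtype.val ⁻¹' (V : Set M) : Set U) ∈ 𝓝 (⟨x₀, h hx₀⟩ : U) :=
        (V.isOpen.preimage continuous_subtype_val).mem_nhds hx₀
      filter_upwards [hmem] with y hy
      have h0 := res_structureSheaf_apply h u ⟨y.1, hy⟩
      exact h0.symm.trans (congrArg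
        (fun f : C^ω⟮𝓘(ℂ, EuclideanSpace ℂ (Fin n)), V; 𝓘(ℂ, ℂ), ℂ⟯ => f ⟨y.1, hy⟩) hg))
  have : u = 0 := by
    ext y
    exact (key y trivial).self_of_nhds
  exact this

/-- If `H¹_c(M, 𝒪)` is finite-dimensional, then `M` admits the Hartogs phenomenon: the space of
holomorphic functions on `M ∖ K` modulo those extending to `M` is finite-dimensional. -/
theorem hartogsPhenomenon_of_rank_lt [T2Space M] [IsManifold 𝓘(ℂ, EuclideanSpace ℂ (Fin n)) ω M]
    [PreconnectedSpace M] [NoncompactSpace M]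
    (h : Module.rank ℂ (compactCohomology (TopCat.of M) 1 (structureSheaf n M)) < Cardinal.aleph0) :
    HartogsPhenomenon n M := by
  intro K hK hKc
  let U : Opens M := ⟨Kᶜ, hK.isClosed.isOpen_compl⟩
  have hinj : Function.Injective (res (X := TopCat.of M) (structureSheaf n M) (le_top : U ≤ ⊤)) := by
    rw [← LinearMap.ker_eq_bot, Submodule.eq_bot_iff]
    exact fun g hg => eq_zero_of_res_eq_zero le_top isPreconnected_univ hKc.nonempty g hg
  refine ⟨hinj, ?_⟩
  have hrank := (rank_quotient_range_res_le (M := TopCat.of M) (G := structureSheaf n M) hK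
    (U := U) rfl (by
      intro L V hL hV g hg
      refine eq_zero_of_res_eq_zero inf_le_left hKc.isPreconnected ?_ g hg
      by_contra hemp
      rw [Set.not_nonempty_iff_eq_empty] at hemp
      refine noncompact_univ M ((hK.union hL).of_isClosed_subset isClosed_univ fun x _ => ?_)
      by_contra hx
      rw [Set.mem_union, not_or] at hx
      have hxV : x ∈ (V : Set M) := hV.ge hx.2
      have : x ∈ ((U ⊓ V : Opens M) : Set M) := ⟨hx.1, hxV⟩
      rw [hemp] at this
      exact this)).trans_lt h
  have hrange : ∀ f : C^ω⟮𝓘(ℂ, EuclideanSpace ℂ (Fin n)), U; 𝓘(ℂ, ℂ), ℂ⟯,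
      (∃ g, res (X := TopCat.of M) (structureSheaf n M) (le_top : U ≤ ⊤) g = f) ↔
        ∃ g, restrictHolAlgHom (EuclideanSpace ℂ (Fin n)) U g = f := by
    intro f
    constructor
    · rintro ⟨g, hg⟩
      let g' : C^ω⟮𝓘(ℂ, EuclideanSpace ℂ (Fin n)), (⊤ : Opens M); 𝓘(ℂ, ℂ), ℂ⟯ := g
      refine ⟨⟨fun x => g' ⟨x, trivial⟩, fun x => ?_⟩, hg⟩
      exact (contMDiffAt_subtype_iff (U := (⊤ : Opens M)) (x := ⟨x, trivial⟩)
        (f := fun x : M => g' ⟨x, trivial⟩)).1 (g'.contMDiff _)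
    · rintro ⟨g, hg⟩
      exact ⟨(restrictHolAlgHom (EuclideanSpace ℂ (Fin n)) ⊤ g :
        C^ω⟮𝓘(ℂ, EuclideanSpace ℂ (Fin n)), (⊤ : Opens M); 𝓘(ℂ, ℂ), ℂ⟯), hg⟩
  have hfin : FiniteDimensional ℂ (C^ω⟮𝓘(ℂ, EuclideanSpace ℂ (Fin n)), U; 𝓘(ℂ, ℂ), ℂ⟯ ⧸
      LinearMap.range (restrictHolAlgHom (EuclideanSpace ℂ (Fin n)) U).toLinearMap) := by
    let N := LinearMap.range (res (X := TopCat.of M) (structureSheaf n M) (le_top : U ≤ ⊤))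
    have hN : FiniteDimensional ℂ ((structureSheaf n M).presheaf.obj (op U) ⧸ N) :=
      Module.rank_lt_aleph0_iff.1 hrank
    let e : (structureSheaf n M).presheaf.obj (op U) ≃ₗ[ℂ]
        C^ω⟮𝓘(ℂ, EuclideanSpace ℂ (Fin n)), U; 𝓘(ℂ, ℂ), ℂ⟯ := LinearEquiv.refl ℂ _
    refine Module.Finite.equiv (Submodule.Quotient.equiv N _ e ?_)
    exact (Submodule.map_id N).trans (Submodule.ext fun f => hrange f)
  intro f
  exact (hrange f).2 (restrictHolAlgHom_surjective (E := EuclideanSpace ℂ (Fin n)) hKc hfin f)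

end HartogsOfFinite

end Hartogs

end

/-! ### Extension of sections near the analytic set -/

noncomputable section

open Topology

namespace Hartogs

section Equivalences

variable {n : ℕ} {X : Type} [TopologicalSpace X] [ChartedSpace (EuclideanSpace ℂ (Fin n)) X]
  [IsManifold 𝓘(ℂ, EuclideanSpace ℂ (Fin n)) ω X]
  {Z : Set X} {Y : Opens X} {F : TopCat.Sheaf (ModuleCat.{0} ℂ) (TopCat.of X)}

/-- If `X ∖ Z` admits the Hartogs phenomenon, then sections of `F` near `Z` extend to `X`: such a
section is, on a connected neighbourhood `V` of `Z`, a holomorphic function on `V ∖ Z`, which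
extends to `X ∖ Z` because `V ∖ Z` is connected. -/
theorem restrictToSubset_surjective [T2Space X] [CompactSpace X]
    (hthin : IsThin (EuclideanSpace ℂ (Fin n)) Z) (hint : ∀ x, Z ∉ 𝓝 x) (hZ : IsClosed Z)
    (hconn : IsConnected Z) (hY : (Y : Set X) = Zᶜ)
    (e : (restrictOpen Y).obj F ≅ structureSheaf n Y) (h : HartogsPhenomenon n Y) :
    Function.Surjective (restrictToSubset Z F) := by
  intro σ
  obtain ⟨U, hU, t, ht⟩ := exists_toSectionsOn_eq hZ.isCompact σ
  obtain ⟨z₀, hz₀⟩ := hconn.nonempty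
  have := ChartedSpace.locallyConnectedSpace (EuclideanSpace ℂ (Fin n)) X
  -- shrink `U` to its connected component containing `Z`
  let V : Opens (TopCat.of X) := ⟨connectedComponentIn (U : Set X) z₀,
    U.isOpen.connectedComponentIn⟩
  have hVU : V ≤ U := connectedComponentIn_subset _ _
  have hZV : Z ⊆ V := hconn.isPreconnected.subset_connectedComponentIn hz₀ hU
  have hVZ : IsConnected ((V : Set X) \ Z) := by
    refine ⟨?_, hthin.isPreconnected_diff hZ isPreconnected_connectedComponentIn V.isOpen⟩
    by_contra hemp
    rw [Set.not_nonempty_iff_eq_empty, Set.sdiff_eq_empty] at hemp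
    exact hint z₀ (Filter.mem_of_superset (V.isOpen.mem_nhds (hZV hz₀)) hemp)
  have hYZ : ∀ x, x ∈ Y ↔ x ∉ Z := fun x => by
    change x ∈ (Y : Set X) ↔ _
    rw [hY]; exact Iff.rfl
  let K : Set Y := Subtype.val ⁻¹' (V : Set X)ᶜ
  have hK : IsCompact K :=
    Topology.IsInducing.subtypeVal.isCompact_preimage' V.isOpen.isClosed_compl.isCompact
      fun x hx => ⟨⟨x, (hYZ x).2 fun hxZ => hx (hZV hxZ)⟩, rfl⟩
  have hKc : IsConnected Kᶜ := by
    have himage : Subtype.val '' Kᶜ = (V : Set X) \ Z := by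
      ext x
      constructor
      · rintro ⟨y, hy, rfl⟩
        exact ⟨not_not.1 hy, (hYZ y).1 y.2⟩
      · rintro ⟨hxV, hxZ⟩
        exact ⟨⟨x, (hYZ x).2 hxZ⟩, fun hx => hx hxV, rfl⟩
    rw [← himage] at hVZ
    exact ⟨hVZ.nonempty.of_image,
      Topology.IsInducing.subtypeVal.isPreconnected_image.1 hVZ.isPreconnected⟩
  let W : Opens (TopCat.of Y) := ⟨Kᶜ, hK.isClosed.isOpen_compl⟩
  have hWV : imageOpen Y W ≤ V := by
    intro x hx
    obtain ⟨hxY, hxW⟩ := (mem_imageOpen Y).1 hx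
    exact not_not.1 hxW
  have hTV : imageOpen Y ⊤ ⊓ V ≤ imageOpen Y W := by
    rintro x ⟨hxT, hxV⟩
    obtain ⟨hxY, -⟩ := (mem_imageOpen Y).1 hxT
    exact (mem_imageOpen Y).2 ⟨hxY, fun hx => hx hxV⟩
  -- the holomorphic function on `V ∖ Z` given by `t`, and its extension to `Y`
  let t' : ((restrictOpen Y).obj F).presheaf.obj (op W) := res F (hWV.trans hVU) t
  obtain ⟨g, hg⟩ := (h K hK hKc).2 (app e.hom W t')
  have hg' : res (structureSheaf n Y) (le_top : W ≤ ⊤) g = app e.hom W t' := hg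
  have hs : res ((restrictOpen Y).obj F) (le_top : W ≤ ⊤) (app e.inv ⊤ g) = t' := by
    rw [← app_res, hg', ← app_comp, e.hom_inv_id, app_id]
  let s : F.presheaf.obj (op (imageOpen Y ⊤)) := app e.inv ⊤ g
  have hs' : res F (imageOpen_mono Y le_top) s = res F (hWV.trans hVU) t := hs
  have hcov : (⊤ : Opens (TopCat.of X)) ≤ imageOpen Y ⊤ ⊔ V := by
    intro x _
    by_cases hx : x ∈ Z
    · exact Or.inr (hZV hx)
    · exact Or.inl ((mem_imageOpen Y).2 ⟨(hYZ x).2 hx, trivial⟩)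
  obtain ⟨r, -, hr⟩ := exists_glue (F := F) (le_top : imageOpen Y ⊤ ≤ ⊤) (le_top : V ≤ ⊤) hcov s
    (res F hVU t) (by
      have := congrArg (res F hTV) hs'
      rw [res_res, res_res] at this
      rw [this, res_res])
  refine ⟨r, ?_⟩
  have h₁ := toSectionsOn_res (le_top : V ≤ ⊤) hZV r
  have h₂ := toSectionsOn_res hVU hZV t
  rw [hr] at h₁
  exact h₁.symm.trans (h₂.trans ht)

end Equivalences

end Hartogs

end

theorem lemma2p1 (n : ℕ) (X : Type) [TopologicalSpace X] [T2Space X] [CompactSpace X]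
    [ConnectedSpace X] [ChartedSpace (EuclideanSpace ℂ (Fin n)) X]
    [IsManifold 𝓘(ℂ, EuclideanSpace ℂ (Fin n)) ω X]
    (Z : Set X) (hZ : Hartogs.IsAnalyticSet n Z) (hcodim : Hartogs.HasCodim n Z 1)
    (hconn : IsConnected Z)
    (F : TopCat.Sheaf (ModuleCat.{0} ℂ) (TopCat.of X))
    (hF : Nonempty (Hartogs.inverseImage (hZ.compl : Set X) F ≅ Hartogs.structureSheaf n hZ.compl))
    (m : ℕ) (hm : Module.rank ℂ (Hartogs.cohomology (TopCat.of X) 1 F) = m) :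
    Nonempty (CategoryTheory.Limits.IsColimit (Hartogs.sectionsCocone Z F)) ∧
    List.TFAE [
      Hartogs.HartogsPhenomenon n hZ.compl,
      Function.Surjective (Hartogs.restrictToSubset Z F),
      Module.rank ℂ (Hartogs.compactCohomology (TopCat.of hZ.compl) 1
        (Hartogs.structureSheaf n hZ.compl)) ≤ m] := by
  have hthin := hZ.isThin hcodim one_ne_zero
  have hint := hcodim.notMem_nhds one_ne_zero
  obtain ⟨e₀⟩ := hF
  let e : (Hartogs.restrictOpen hZ.compl).obj F ≅ Hartogs.structureSheaf n hZ.compl :=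
    (Hartogs.inverseImageIso hZ.compl F).symm ≪≫ e₀
  have hrank : Module.rank ℂ (Hartogs.compactCohomology (TopCat.of hZ.compl) 1
      (Hartogs.structureSheaf n hZ.compl)) = Module.rank ℂ (Hartogs.compactCohomology
        (TopCat.of hZ.compl) 1 ((Hartogs.restrictOpen hZ.compl).obj F)) :=
    (((Hartogs.compactGlobalSections (TopCat.of hZ.compl)).rightDerived 1).mapIso
      e).toLinearEquiv.rank_eq.symm
  refine ⟨Hartogs.nonempty_isColimit_sectionsCocone hZ.isClosed.isCompact F, ?_⟩
  tfae_have 1 → 2 := Hartogs.restrictToSubset_surjective hthin hint hZ.isClosed hconn rfl e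
  tfae_have 2 → 3 := fun h => by
    rw [hrank, ← hm]
    exact Hartogs.rank_compactCohomology_le rfl h
  tfae_have 3 → 1 := fun h => by
    have hpre : PreconnectedSpace hZ.compl := by
      refine isPreconnected_iff_preconnectedSpace.1 ?_
      have := hthin.isPreconnected_diff hZ.isClosed isPreconnected_univ isOpen_univ
      rwa [← Set.compl_eq_univ_sdiff] at this
    -- a compact `X ∖ Z` would be closed and open, but `Z` is neither empty nor open
    have hnc : NoncompactSpace hZ.compl := by
      refine not_compactSpace_iff.1 fun hc => ?_
      have hcl : IsClosed (hZ.compl : Set X) := (isCompact_iff_compactSpace.2 hc).isClosed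
      obtain ⟨z, hz⟩ := hconn.nonempty
      refine hint z (IsOpen.mem_nhds ?_ hz)
      rw [← compl_compl Z]
      exact hcl.isOpen_compl
    exact Hartogs.hartogsPhenomenon_of_rank_lt (h.trans_lt Cardinal.natCast_lt_aleph0)
  tfae_finish
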